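/- Let $d\ge 1$, $\beta\in(0,1)$, $a\in[0,1]$, and let $\alpha=(\alpha_x)_{x\in\mathbb Z^d}$ be i.i.d. $\{1,2,\dots\}$-valued random variables with product law $\mathbb Q$ such that $\mathbb Q(\alpha_0>u)=u^{-\beta}(1+o(1))$ as $u\to\infty$. Given $\alpha$, let $X$ be the continuous-time random walk on $\mathbb Z^d$ (Bouchaud trap model) with generator $$Ag(x)=\alpha_x^{a-1}\sum_{y\sim x}\alpha_y^a\,(g(y)-g(x)),$$ where $y\sim x$ means $|y-x|=1$, with transition probabilities $\mathbf P^\alpha_x(X_t=y)$ given by the minimal non-negative solution of the Kolmogorov backward equation. Let $(\eta_t)_{t\ge0}$ be the partial exclusion process on $\Xi=\prod_{x\in\mathbb Z^d}\{0,\dots,\alpha_x\}$, i.e. a càdlàg $\Xi$-valued process solving the martingale problem for the generator $$\mathcal L\varphi(\eta)=\sum_{x\in\mathbb Z^d}\eta(x)\,\alpha_x^{a-1}\sum_{y\sim x}\alpha_y^a\Big(1-\frac{\eta(y)}{\alpha_y}\Big)\big(\varphi(\eta-\delta_x+\delta_y)-\varphi(\eta)\big)$$ on functions $\varphi$ depending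 on finitely many coordinates; $\mathbb E_\eta$ is the expectation when $\eta_0=\eta$. For an integer $n\ge1$ put $\theta_n=n^{1+1/\beta}$ if $d=1$, $\theta_n=n^{2/\beta}(\log n)^{1-1/\beta}$ if $d=2$ (with $\theta_1:=1$), and $\theta_n=n^{2/\beta}$ if $d\ge3$. Let $$\mathcal X^n_t=\frac1{n^{d/\beta}}\sum_{x\in\mathbb Z^d}\eta_{t\theta_n}(x)\,\delta_{x/n},\qquad P^n_tg(x/n)=\mathbf E^\alpha_x\big[g(X_{t\theta_n}/n)\big],\quad x\in\mathbb Z^d,$$ and write $\langle\mu|g\rangle=\int g\,d\mu$. Then, $\mathbb Q$-a.s., for every $\eta\in\Xi$, $t\ge0$, integer $n\ge1$, and every non-negative, continuous, compactly supported $f:\mathbb R^d\to\mathbb R$, all the pairings and the expectation below are well-defined and finite, and $$\mathbb E_\eta\Big[\big(\langle\mathcal X^n_t|f\rangle-\langle\mathcal X^n_0|P^n_tf\rangle\big)^2\Big]\le\frac1{n^{d/\beta}}\,\big\langle\mathcal X^n_0\,\big|\,P^n_t(f^2)-(P^n_tf)^2\big\rangle.$$ -/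

import Mathlib

open MeasureTheory ProbabilityTheory Filter Topology
open scoped NNReal ENNReal

noncomputable section

namespace BouchaudExclusion

/-! ### The random environment -/

/-- The positive integers carry the discrete σ-algebra. -/
instance instMeasurableSpacePNat : MeasurableSpace ℕ+ := ⊤

instance instDiscreteMeasurableSpacePNat : DiscreteMeasurableSpace ℕ+ := ⟨fun _ => trivial⟩

/-- The lattice `ℤ^d`. -/
abbrev Site (d : ℕ) : Type := Fin d → ℤ

/-- Environments `α : ℤ^d → {1, 2, …}`. -/
abbrev Env (d : ℕ) : Type := Site d → ℕ+

/-- The heavy-tail condition `ν(α₀ > u) = u ^ (-β) (1 + o(1))` as `u → ∞` on the one-site law. -/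
def HeavyTailed (ν : Measure ℕ+) (β : ℝ) : Prop :=
  Asymptotics.IsEquivalent atTop
    (fun u : ℝ => ν.real {k : ℕ+ | u < (k : ℝ)}) (fun u : ℝ => u ^ (-β))

/-- The law of an i.i.d. environment with one-site law `ν`: the product measure. -/
def envLaw (d : ℕ) (ν : Measure ℕ+) : Measure (Env d) :=
  Measure.infinitePi fun _ : Site d => ν

/-- The `2d` nearest neighbours `x ± e_i` of `x` in `ℤ^d`. -/
def nbrs {d : ℕ} (x : Site d) : Finset (Site d) :=
  (Finset.univ ×ˢ ({1, -1} : Finset ℤ)).image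
    fun p : Fin d × ℤ => x + Pi.single p.1 p.2

/-! ### The Bouchaud trap model and its rescaled semigroup -/

/-- Jump rate of the Bouchaud trap model `BTM(a)` from `x` to a nearest neighbour `y`, so that its
generator is `A g x = ∑_{y ∼ x} btmRate a α x y * (g y - g x)`. -/
def btmRate {d : ℕ} (a : ℝ) (α : Env d) (x y : Site d) : ℝ :=
  (α x : ℝ) ^ (a - 1) * (α y : ℝ) ^ a

/-- Total jump rate of `BTM(a)` out of `x`. -/
def btmExitRate {d : ℕ} (a : ℝ) (α : Env d) (x : Site d) : ℝ :=
  ∑ y ∈ nbrs x, btmRate a α x y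

/-- Probability that `BTM(a)` started from `x` is at `y` at time `t` after fewer than `k` jumps,
computed by conditioning on the time `s` and the target `z` of the first jump. -/
def btmIter {d : ℕ} (a : ℝ) (α : Env d) : ℕ → ℝ → Site d → Site d → ℝ≥0∞
  | 0, _, _, _ => 0
  | k + 1, t, x, y =>
      (if x = y then ENNReal.ofReal (Real.exp (-(btmExitRate a α x * t))) else 0) +
        ∫⁻ s in Set.Icc (0 : ℝ) t,
          ENNReal.ofReal (Real.exp (-(btmExitRate a α x * s))) *
            ∑ z ∈ nbrs x, ENNReal.ofReal (btmRate a α x z) * btmIter a α k (t - s) z y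

/-- Transition probabilities `𝐏_x(X_t = y)` of the continuous-time random walk `BTM(a)` with the
rates `btmRate`: the increasing limit of `btmIter`, i.e. the minimal non-negative solution of the
Kolmogorov backward equation. No conservativeness (non-explosion) is built in. -/
def btmTransition {d : ℕ} (a : ℝ) (α : Env d) (t : ℝ) (x y : Site d) : ℝ≥0∞ :=
  ⨆ k : ℕ, btmIter a α k t x y

/-- The point `x / n` of `ℝ^d`. -/
def scaledSite {d : ℕ} (n : ℕ) (x : Site d) : EuclideanSpace ℝ (Fin d) :=
  WithLp.toLp 2 fun i => (x i : ℝ) / (n : ℝ)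

/-- The time scale `θ_n`. For `d = 2` and `n = 1` the formula has a vanishing logarithm raised to
a negative power; we set `θ_1 = 1` there, which is its value in all other dimensions. -/
def timeScale (d : ℕ) (β : ℝ) (n : ℕ) : ℝ≥0 :=
  Real.toNNReal <|
    if d = 1 then (n : ℝ) ^ (1 + 1 / β)
    else if d = 2 then
      if n = 1 then 1 else (n : ℝ) ^ (2 / β) * Real.log n ^ (1 - 1 / β)
    else (n : ℝ) ^ (2 / β)

/-- The rescaled semigroup `P^n_t g (x / n) = 𝐄_x[g(X_{t θ_n} / n)]`. It is a function on the
rescaled lattice `ℤ^d / n`, extended to `ℝ^d` by `0`; only its values on `ℤ^d / n` are ever used. -/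
def semigroup {d : ℕ} (a β : ℝ) (α : Env d) (n : ℕ) (t : ℝ≥0)
    (g : EuclideanSpace ℝ (Fin d) → ℝ) : EuclideanSpace ℝ (Fin d) → ℝ :=
  Function.extend (scaledSite n)
    (fun x : Site d => ∑' y : Site d,
      (btmTransition a α ((t * timeScale d β n : ℝ≥0) : ℝ) x y).toReal * g (scaledSite n y))
    0

/-! ### The partial exclusion process -/

/-- Configurations `Ξ = ∏_x {0, …, α_x}`, with the product topology and σ-algebra. -/
abbrev Config {d : ℕ} (α : Env d) : Type := ∀ x : Site d, Fin ((α x : ℕ) + 1)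

/-- The configuration `η^{x,y}` (for `x ≠ y`): one particle of `η` is moved from `x` to `y`, if
there is a particle at `x` and room at `y`. -/
def move {d : ℕ} {α : Env d} (η : Config α) (x y : Site d) : Config α :=
  if h : 0 < (η x : ℕ) ∧ (η y : ℕ) < (α y : ℕ) then
    Function.update
      (Function.update η x ⟨(η x : ℕ) - 1, lt_of_le_of_lt (Nat.sub_le _ _) (η x).isLt⟩)
      y ⟨(η y : ℕ) + 1, Nat.succ_lt_succ h.2⟩
  else η

/-- Local functions: those which depend on finitely many sites only. -/
def IsLocal {d : ℕ} {α : Env d} (φ : Config α → ℝ) : Prop :=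
  ∃ S : Finset (Site d), DependsOn φ (S : Set (Site d))

/-- The generator of the exclusion process. For a local function `φ` only finitely many terms of
the sum over `x` are nonzero. -/
def exclGen {d : ℕ} (a : ℝ) (α : Env d) (φ : Config α → ℝ) (η : Config α) : ℝ :=
  ∑' x : Site d, ∑ y ∈ nbrs x,
    ((η x : ℕ) : ℝ) * (α x : ℝ) ^ (a - 1) * ((α y : ℝ) ^ a * (1 - ((η y : ℕ) : ℝ) / (α y : ℝ))) *
      (φ (move η x y) - φ η)

/-- `ξ` is, under `P`, the partial exclusion process with generator `exclGen a α` on local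
functions, started from `η`: a càdlàg process which solves the martingale problem. -/
structure IsExclusionProcess {d : ℕ} (a : ℝ) (α : Env d) (η : Config α)
    {Ω : Type*} {mΩ : MeasurableSpace Ω} (P : Measure Ω) (ξ : ℝ≥0 → Ω → Config α) : Prop where
  right_continuous : ∀ ω t, ContinuousWithinAt (fun s => ξ s ω) (Set.Ici t) t
  left_limits : ∀ ω t, ∃ ζ : Config α, Tendsto (fun s => ξ s ω) (𝓝[<] t) (𝓝 ζ)
  initial : ∀ᵐ ω ∂P, ξ 0 ω = η
  martingale_problem : ∃ ℱ : Filtration ℝ≥0 mΩ, (∀ t, Measurable[ℱ t] (ξ t)) ∧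
    ∀ φ : Config α → ℝ, IsLocal φ →
      Martingale
        (fun (t : ℝ≥0) (ω : Ω) =>
          φ (ξ t ω) - φ (ξ 0 ω) - ∫ s in (0 : ℝ)..t, exclGen a α φ (ξ s.toNNReal ω))
        ℱ P

/-- The empirical density field `n ^ (-d/β) ∑_x η(x) δ_{x/n}` of a configuration `η`. -/
def densityField {d : ℕ} (β : ℝ) (n : ℕ) {α : Env d} (η : Config α) :
    Measure (EuclideanSpace ℝ (Fin d)) :=
  ENNReal.ofReal (1 / (n : ℝ) ^ ((d : ℝ) / β)) •
    Measure.sum fun x : Site d => ((η x : ℕ) : ℝ≥0∞) • Measure.dirac (scaledSite n x)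

end BouchaudExclusion

end

/-! For independent walkers the variance of `⟨η_t, f⟩` is exactly `⟨η_0, P_t(f²) - (P_t f)²⟩`.
Exclusion is no worse, for two reasons. On linear functionals the interaction term is symmetric in
`x, y` and cancels, so the generator acts as that of one walker (`exclGen_pairing`). On squares the
only new term is the carré du champ, whose jump rates are at most `η(x)` times the free rates
(`exclGen_pairing_sq_le`). Differentiating `E⟨η_s, P_{t-s}f⟩² - E⟨η_s, (P_{t-s}f)²⟩` in `s` would
then suffice.

The difficulty is that `P_{t-s}f` need not have finite support, while the martingale problem speaks
of local functions only and jump rates need not be bounded over the lattice. The semigroup is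
therefore truncated to fewer than `k` jumps, which keeps supports finite at the price of a
non-negative source `D` in the backward equation. As `η ≤ α`, the effect of `D` is bounded by the
growth of the `α`-mass of the truncated semigroup (`expect_sq_le`). By reversibility that growth is
governed by the probability of making `k` jumps before `t`, hence by `𝐄[exp(-τ_k)]`
(`sub_sum_truncSemigroup_le`).

This error vanishes as `k → ∞` if the walk does not explode. A maximum principle
(`tendsto_jumpLaplace`) yields this when no infinite self-avoiding path consists of fast sites. A
counting argument over chains of deep traps shows that almost every environment has this property
(`ae_exists_noFastPath`). Dominated convergence then gives `IsExclusionProcess.variance_le`. -/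

noncomputable section

namespace BouchaudExclusion

/-! ### Truncated transition probabilities: Kolmogorov equations, reversibility, lost mass. -/

section Walk

variable {d : ℕ} {a : ℝ} {α : Env d}

lemma mem_nbrs_iff {x y : Site d} :
    y ∈ nbrs x ↔ ∃ i : Fin d, y = x + Pi.single i 1 ∨ y = x + Pi.single i (-1) := by
  simp [nbrs, eq_comm]

lemma mem_nbrs_comm {x y : Site d} : y ∈ nbrs x ↔ x ∈ nbrs y := by
  have key : ∀ x y : Site d, y ∈ nbrs x → x ∈ nbrs y := by
    intro x y h
    obtain ⟨i, rfl | rfl⟩ := mem_nbrs_iff.1 h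
    · exact mem_nbrs_iff.2 ⟨i, .inr (by simp [add_assoc, ← Pi.single_add])⟩
    · exact mem_nbrs_iff.2 ⟨i, .inl (by simp [add_assoc, ← Pi.single_add])⟩
  exact ⟨key x y, key y x⟩

lemma ne_of_mem_nbrs {x y : Site d} (h : y ∈ nbrs x) : x ≠ y := by
  rintro rfl
  obtain ⟨i, h | h⟩ := mem_nbrs_iff.1 h <;> simpa using congrFun h i

lemma card_nbrs_le (x : Site d) : (nbrs x).card ≤ 2 * d := by
  refine Finset.card_image_le.trans ?_
  simp [Finset.card_product, mul_comm]

lemma env_pos (α : Env d) (x : Site d) : (0 : ℝ) < α x := by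
  exact_mod_cast (α x).pos

lemma btmRate_nonneg (x y : Site d) : 0 ≤ btmRate a α x y :=
  mul_nonneg (Real.rpow_nonneg (env_pos α x).le _) (Real.rpow_nonneg (env_pos α y).le _)

lemma btmExitRate_nonneg (x : Site d) : 0 ≤ btmExitRate a α x :=
  Finset.sum_nonneg fun _ _ => btmRate_nonneg _ _

/-- Detailed balance of `BTM(a)` with respect to the measure `α`. -/
lemma env_mul_btmRate_comm (x y : Site d) :
    (α x : ℝ) * btmRate a α x y = α y * btmRate a α y x := by
  have h : ∀ z, (α z : ℝ) * (α z : ℝ) ^ (a - 1) = (α z : ℝ) ^ a := fun z => by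
    rw [Real.rpow_sub_one (env_pos α z).ne']
    field_simp [(env_pos α z).ne']
  simp only [btmRate, ← mul_assoc, h]
  exact mul_comm _ _

/-- A scalar comparison principle for the linear equation `E' = -q E + h` with `0 ≤ h`. -/
lemma nonneg_of_hasDerivAt {q : ℝ} {E h : ℝ → ℝ}
    (hE : ∀ t, 0 ≤ t → HasDerivAt E (-q * E t + h t) t) (hh : ∀ t, 0 ≤ t → 0 ≤ h t)
    (h0 : 0 ≤ E 0) {t : ℝ} (ht : 0 ≤ t) : 0 ≤ E t := by
  -- Integrating factor: `exp(q s) E(s)` has derivative `exp(q s) h(s) ≥ 0`.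
  have hd : ∀ s, 0 ≤ s →
      HasDerivAt (fun s => Real.exp (q * s) * E s) (Real.exp (q * s) * h s) s := by
    intro s hs
    have h1 : HasDerivAt (fun s => Real.exp (q * s)) (Real.exp (q * s) * q) s := by
      simpa using ((hasDerivAt_id s).const_mul q).exp
    refine (h1.fun_mul (hE s hs)).congr_deriv ?_
    ring
  have hm : MonotoneOn (fun s => Real.exp (q * s) * E s) (Set.Ici 0) := by
    refine monotoneOn_of_hasDerivWithinAt_nonneg (convex_Ici 0)
      (fun s hs => (hd s hs).continuousAt.continuousWithinAt)
      (f' := fun s => Real.exp (q * s) * h s) ?_ ?_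
    · intro s hs
      rw [interior_Ici] at hs
      exact (hd s (le_of_lt hs)).hasDerivWithinAt
    · intro s hs
      rw [interior_Ici] at hs
      exact mul_nonneg (Real.exp_nonneg _) (hh s (le_of_lt hs))
  have := hm Set.self_mem_Ici ht ht
  simp only [mul_zero, Real.exp_zero, one_mul] at this
  exact nonneg_of_mul_nonneg_right (h0.trans this) (Real.exp_pos _)

/-- Comparison for `E` and `-E`. Identities are proved with it by induction on the number of jumps:
the difference of the two sides solves a linear equation whose source is the same difference one
level lower. -/
lemma eq_zero_of_hasDerivAt {q : ℝ} {E h : ℝ → ℝ}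
    (hE : ∀ t, 0 ≤ t → HasDerivAt E (-q * E t + h t) t) (hh : ∀ t, 0 ≤ t → h t = 0)
    (h0 : E 0 = 0) {t : ℝ} (ht : 0 ≤ t) : E t = 0 := by
  refine le_antisymm ?_ (nonneg_of_hasDerivAt hE (fun t ht => (hh t ht).ge) h0.ge ht)
  have : 0 ≤ -E t := nonneg_of_hasDerivAt (q := q) (E := fun t => -E t) (h := fun t => -h t)
    (fun t ht => (hE t ht).fun_neg.congr_deriv (by ring)) (fun t ht => by simp [hh t ht])
    (by simp [h0]) ht
  linarith

/-- The real-valued counterpart of `btmIter`. -/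
def btmProb (a : ℝ) (α : Env d) : ℕ → ℝ → Site d → Site d → ℝ
  | 0, _, _, _ => 0
  | k + 1, t, x, y =>
      Real.exp (-(btmExitRate a α x * t)) * ((if x = y then 1 else 0) +
        ∫ u in (0 : ℝ)..t, Real.exp (btmExitRate a α x * u) *
          ∑ z ∈ nbrs x, btmRate a α x z * btmProb a α k u z y)

lemma continuous_btmProb (k : ℕ) (x y : Site d) :
    Continuous fun t => btmProb a α k t x y := by
  induction k generalizing x with
  | zero => exact continuous_const
  | succ k ih =>
    have : Continuous fun u => Real.exp (btmExitRate a α x * u) *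
        ∑ z ∈ nbrs x, btmRate a α x z * btmProb a α k u z y := by
      fun_prop
    have h2 := intervalIntegral.continuous_primitive (fun a b => this.intervalIntegrable a b) 0
      (μ := volume)
    simp only [btmProb]
    fun_prop

/-- The Kolmogorov backward equation, truncated by the number of jumps. -/
lemma hasDerivAt_btmProb (k : ℕ) (x y : Site d) (t : ℝ) :
    HasDerivAt (fun t => btmProb a α (k + 1) t x y)
      (-btmExitRate a α x * btmProb a α (k + 1) t x y
        + ∑ z ∈ nbrs x, btmRate a α x z * btmProb a α k t z y) t := by
  have hc : ∀ z, Continuous fun t => btmProb a α k t z y := fun z => continuous_btmProb k z y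
  have hc' : Continuous fun u => Real.exp (btmExitRate a α x * u) *
      ∑ z ∈ nbrs x, btmRate a α x z * btmProb a α k u z y := by fun_prop
  have h1 := (intervalIntegral.integral_hasDerivAt_right (hc'.intervalIntegrable 0 t)
    (hc'.stronglyMeasurableAtFilter _ _) hc'.continuousAt).const_add (if x = y then (1 : ℝ) else 0)
  have h2 : HasDerivAt (fun s => Real.exp (-(btmExitRate a α x * s)))
      (Real.exp (-(btmExitRate a α x * t)) * -btmExitRate a α x) t := by
    simpa using ((hasDerivAt_id t).const_mul (btmExitRate a α x)).neg.exp
  have h3 := h2.mul h1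
  simp only [btmProb] at *
  refine h3.congr_deriv ?_
  rw [← mul_assoc, ← Real.exp_add, neg_add_cancel, Real.exp_zero]
  ring

lemma btmProb_succ_zero (k : ℕ) (x y : Site d) :
    btmProb a α (k + 1) 0 x y = if x = y then 1 else 0 := by
  simp [btmProb]

lemma btmProb_nonneg (k : ℕ) (x y : Site d) {t : ℝ} (ht : 0 ≤ t) : 0 ≤ btmProb a α k t x y := by
  induction k generalizing x t with
  | zero => exact le_rfl
  | succ k ih =>
    refine nonneg_of_hasDerivAt (fun t _ => hasDerivAt_btmProb k x y t) (fun t ht => ?_) ?_ ht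
    · exact Finset.sum_nonneg fun z _ => mul_nonneg (btmRate_nonneg _ _) (ih z ht)
    · rw [btmProb_succ_zero]; split_ifs <;> norm_num

lemma btmProb_le_succ (k : ℕ) (x y : Site d) {t : ℝ} (ht : 0 ≤ t) :
    btmProb a α k t x y ≤ btmProb a α (k + 1) t x y := by
  induction k generalizing x t with
  | zero => exact btmProb_nonneg 1 x y ht
  | succ k ih =>
    rw [← sub_nonneg]
    refine nonneg_of_hasDerivAt (q := btmExitRate a α x)
      (E := fun t => btmProb a α (k + 1 + 1) t x y - btmProb a α (k + 1) t x y)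
      (h := fun t => ∑ z ∈ nbrs x,
        btmRate a α x z * (btmProb a α (k + 1) t z y - btmProb a α k t z y))
      (fun t _ => ?_) (fun t ht => ?_) ?_ ht
    · refine ((hasDerivAt_btmProb (k + 1) x y t).sub (hasDerivAt_btmProb k x y t)).congr_deriv ?_
      simp only [mul_sub, Finset.sum_sub_distrib]
      ring
    · exact Finset.sum_nonneg fun z _ => mul_nonneg (btmRate_nonneg _ _) (sub_nonneg.2 (ih z ht))
    · simp only [btmProb_succ_zero, sub_self, le_refl]

lemma btmProb_monotone (x y : Site d) {t : ℝ} (ht : 0 ≤ t) :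
    Monotone fun k => btmProb a α k t x y :=
  monotone_nat_of_le_succ fun k => btmProb_le_succ k x y ht

lemma btmIter_eq_ofReal (k : ℕ) (x y : Site d) {t : ℝ} (ht : 0 ≤ t) :
    btmIter a α k t x y = ENNReal.ofReal (btmProb a α k t x y) := by
  induction k generalizing x t with
  | zero => simp [btmIter, btmProb]
  | succ k ih =>
    set q := btmExitRate a α x with hq
    have hcP : ∀ z, Continuous fun t => btmProb a α k t z y := fun z => continuous_btmProb k z y
    set F : ℝ → ℝ := fun s => Real.exp (-(q * s)) *
      ∑ z ∈ nbrs x, btmRate a α x z * btmProb a α k (t - s) z y with hF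
    have hFc : Continuous F := by
      have : ∀ z, Continuous fun s => btmProb a α k (t - s) z y := fun z =>
        (hcP z).comp (continuous_const.sub continuous_id)
      simp only [hF]
      fun_prop
    have h1 : ∫⁻ s in Set.Icc (0 : ℝ) t, ENNReal.ofReal (Real.exp (-(q * s))) *
        ∑ z ∈ nbrs x, ENNReal.ofReal (btmRate a α x z) * btmIter a α k (t - s) z y
        = ENNReal.ofReal (∫ s in (0 : ℝ)..t, F s) := by
      rw [intervalIntegral.integral_of_le ht, ← integral_Icc_eq_integral_Ioc,
        ofReal_integral_eq_lintegral_ofReal]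
      · refine setLIntegral_congr_fun measurableSet_Icc fun s hs => ?_
        have hts : 0 ≤ t - s := sub_nonneg.2 hs.2
        simp only [hF]
        rw [ENNReal.ofReal_mul (Real.exp_nonneg _), ENNReal.ofReal_sum_of_nonneg]
        · congr 1
          refine Finset.sum_congr rfl fun z _ => ?_
          rw [ENNReal.ofReal_mul (btmRate_nonneg _ _), ih z hts]
        · exact fun z _ => mul_nonneg (btmRate_nonneg _ _) (btmProb_nonneg k z y hts)
      · exact hFc.continuousOn.integrableOn_Icc
      · refine (ae_restrict_iff' measurableSet_Icc).2 (ae_of_all _ fun s hs => ?_)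
        exact mul_nonneg (Real.exp_nonneg _) (Finset.sum_nonneg fun z _ =>
          mul_nonneg (btmRate_nonneg _ _) (btmProb_nonneg k z y (sub_nonneg.2 hs.2)))
    -- The substitution `u = t - s` moves `t` out of the integrand, leaving a primitive that can be
    -- differentiated in `t`.
    have h2 : ∫ s in (0 : ℝ)..t, F s = Real.exp (-(q * t)) *
        ∫ u in (0 : ℝ)..t, Real.exp (q * u) *
          ∑ z ∈ nbrs x, btmRate a α x z * btmProb a α k u z y := by
      have := intervalIntegral.integral_comp_sub_left (a := 0) (b := t)
        (fun u => Real.exp (-(q * (t - u))) *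
          ∑ z ∈ nbrs x, btmRate a α x z * btmProb a α k u z y) t
      simp only [sub_sub_cancel, sub_self, sub_zero] at this
      simp only [hF]
      rw [this, ← intervalIntegral.integral_const_mul]
      refine intervalIntegral.integral_congr fun u _ => ?_
      rw [← mul_assoc, ← Real.exp_add]
      ring_nf
    have h3 : 0 ≤ ∫ s in (0 : ℝ)..t, F s := by
      refine intervalIntegral.integral_nonneg ht fun s hs => ?_
      exact mul_nonneg (Real.exp_nonneg _) (Finset.sum_nonneg fun z _ =>
          mul_nonneg (btmRate_nonneg _ _) (btmProb_nonneg k z y (sub_nonneg.2 hs.2)))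
    rw [btmIter, ← hq, h1, btmProb, ← hq, mul_add, ← h2, ENNReal.ofReal_add _ h3]
    · congr 1
      split_ifs <;> simp
    · split_ifs <;> simp [Real.exp_nonneg]

/-- The Kolmogorov forward equation, truncated by the number of jumps. -/
lemma btmProb_forward (k : ℕ) (x y : Site d) {t : ℝ} (ht : 0 ≤ t) :
    -btmExitRate a α x * btmProb a α (k + 1) t x y
        + ∑ z ∈ nbrs x, btmRate a α x z * btmProb a α k t z y
      = -btmExitRate a α y * btmProb a α (k + 1) t x y
        + ∑ z ∈ nbrs y, btmProb a α k t x z * btmRate a α z y := by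
  induction k generalizing x t with
  | zero =>
    by_cases h : x = y
    · simp [btmProb, h]
    · simp [btmProb, h]
  | succ k ih =>
    rw [← sub_eq_zero]
    -- The source `h` is the induction hypothesis at each neighbour `z` of `x`, weighted by the rate
    -- from `x` to `z`.
    refine eq_zero_of_hasDerivAt (q := btmExitRate a α x)
      (E := fun t => (-btmExitRate a α x * btmProb a α (k + 1 + 1) t x y
        + ∑ z ∈ nbrs x, btmRate a α x z * btmProb a α (k + 1) t z y)
        - (-btmExitRate a α y * btmProb a α (k + 1 + 1) t x y
        + ∑ z ∈ nbrs y, btmProb a α (k + 1) t x z * btmRate a α z y))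
      (h := fun t => ∑ z ∈ nbrs x, btmRate a α x z *
        ((-btmExitRate a α z * btmProb a α (k + 1) t z y
          + ∑ w ∈ nbrs z, btmRate a α z w * btmProb a α k t w y)
        - (-btmExitRate a α y * btmProb a α (k + 1) t z y
          + ∑ w ∈ nbrs y, btmProb a α k t z w * btmRate a α w y))) (fun t _ => ?_)
      (fun t ht => ?_) ?_ ht
    · have h1 := hasDerivAt_btmProb (a := a) (α := α) (k + 1) x y t
      have h2 : HasDerivAt (fun t => ∑ z ∈ nbrs x, btmRate a α x z * btmProb a α (k + 1) t z y)
          _ t := HasDerivAt.fun_sum fun z _ => (hasDerivAt_btmProb k z y t).const_mul _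
      have h3 : HasDerivAt (fun t => ∑ z ∈ nbrs y, btmProb a α (k + 1) t x z * btmRate a α z y)
          _ t := HasDerivAt.fun_sum fun z _ => (hasDerivAt_btmProb k x z t).mul_const _
      refine (((h1.const_mul _).add h2).sub ((h1.const_mul _).add h3)).congr_deriv ?_
      have e : ∑ z ∈ nbrs y, (∑ w ∈ nbrs x, btmRate a α x w * btmProb a α k t w z)
            * btmRate a α z y
          = ∑ z ∈ nbrs x, btmRate a α x z *
            ∑ w ∈ nbrs y, btmProb a α k t z w * btmRate a α w y := by
        simp only [Finset.sum_mul, Finset.mul_sum]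
        rw [Finset.sum_comm]
        simp only [mul_assoc]
      have e1 : ∑ z ∈ nbrs x, btmRate a α x z * (btmExitRate a α y * btmProb a α (k + 1) t z y)
          = btmExitRate a α y * ∑ z ∈ nbrs x, btmRate a α x z * btmProb a α (k + 1) t z y := by
        rw [Finset.mul_sum]
        exact Finset.sum_congr rfl fun _ _ => by ring
      have e2 : ∑ z ∈ nbrs y, btmExitRate a α x * btmProb a α (k + 1) t x z * btmRate a α z y
          = btmExitRate a α x * ∑ z ∈ nbrs y, btmProb a α (k + 1) t x z * btmRate a α z y := by
        rw [Finset.mul_sum]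
        exact Finset.sum_congr rfl fun _ _ => by ring
      simp only [add_mul, mul_sub, mul_add, Finset.sum_add_distrib, Finset.sum_sub_distrib, e,
        neg_mul, mul_neg, Finset.sum_neg_distrib, e1, e2]
      ring
    · exact Finset.sum_eq_zero fun z _ => by rw [ih z ht, sub_self, mul_zero]
    · simp only [btmProb_succ_zero]
      by_cases h : x = y
      · subst h
        simp
      · simp only [if_neg h, mul_zero, zero_add, mul_ite, mul_one, ite_mul, one_mul, zero_mul,
          Finset.sum_ite_eq, Finset.sum_ite_eq']
        simp [mem_nbrs_comm (x := x)]

/-- Reversibility of the truncated transition probabilities with respect to `α`. -/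
lemma env_mul_btmProb_comm (k : ℕ) (x y : Site d) {t : ℝ} (ht : 0 ≤ t) :
    (α x : ℝ) * btmProb a α k t x y = α y * btmProb a α k t y x := by
  induction k generalizing x t with
  | zero => simp [btmProb]
  | succ k ih =>
    rw [← sub_eq_zero]
    refine eq_zero_of_hasDerivAt (q := btmExitRate a α x)
      (E := fun t => (α x : ℝ) * btmProb a α (k + 1) t x y - α y * btmProb a α (k + 1) t y x)
      (h := fun t => ∑ z ∈ nbrs x, btmRate a α z x *
        ((α z : ℝ) * btmProb a α k t z y - α y * btmProb a α k t y z)) (fun t ht => ?_)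
      (fun t ht => ?_) ?_ ht
    · refine (((hasDerivAt_btmProb k x y t).const_mul _).sub
        ((hasDerivAt_btmProb k y x t).const_mul _)).congr_deriv ?_
      -- The forward equation for the path from `y` to `x` gives both derivatives the exit rate of
      -- `x` and a sum over `nbrs x`; detailed balance then matches the terms.
      rw [btmProb_forward k y x ht]
      have e : (α x : ℝ) * ∑ z ∈ nbrs x, btmRate a α x z * btmProb a α k t z y
          = ∑ z ∈ nbrs x, btmRate a α z x * (α z * btmProb a α k t z y) := by
        rw [Finset.mul_sum]
        refine Finset.sum_congr rfl fun z _ => ?_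
        rw [← mul_assoc, env_mul_btmRate_comm]
        ring
      have e2 : (α y : ℝ) * ∑ z ∈ nbrs x, btmProb a α k t y z * btmRate a α z x
          = ∑ z ∈ nbrs x, btmRate a α z x * (α y * btmProb a α k t y z) := by
        rw [Finset.mul_sum]
        exact Finset.sum_congr rfl fun z _ => by ring
      rw [mul_add, e, mul_add, e2]
      simp only [mul_sub, Finset.sum_sub_distrib]
      ring
    · exact Finset.sum_eq_zero fun z _ => by rw [ih z ht, sub_self, mul_zero]
    · simp only [btmProb_succ_zero]
      by_cases h : x = y
      · simp [h]
      · simp [h, Ne.symm h]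

/-- The sites at distance at most one from a finite set. -/
def fatten (S : Finset (Site d)) : Finset (Site d) := S ∪ S.biUnion nbrs

lemma subset_fatten (S : Finset (Site d)) : S ⊆ fatten S := Finset.subset_union_left

lemma mem_fatten_of_mem_nbrs {S : Finset (Site d)} {x y : Site d} (hx : x ∈ S)
    (h : y ∈ nbrs x) : y ∈ fatten S :=
  Finset.mem_union_right _ (Finset.mem_biUnion.2 ⟨x, hx, h⟩)

lemma fatten_mono : Monotone (fatten (d := d)) := fun _ _ h =>
  Finset.union_subset_union h (Finset.biUnion_subset_biUnion_of_subset_left _ h)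

lemma btmProb_eq_zero (k : ℕ) (t : ℝ) {x y : Site d} (h : y ∉ fatten^[k] {x}) :
    btmProb a α k t x y = 0 := by
  induction k generalizing x t with
  | zero => rfl
  | succ k ih =>
    have h1 : x ≠ y := by
      rintro rfl
      refine h ?_
      have : ∀ m, ∀ S : Finset (Site d), S ⊆ fatten^[m] S := by
        intro m
        induction m with
        | zero => exact fun S => subset_rfl
        | succ m ihm => exact fun S => (subset_fatten S).trans (ihm _)
      exact this _ _ (Finset.mem_singleton_self x)
    have h2 : ∀ z ∈ nbrs x, ∀ u, btmProb a α k u z y = 0 := by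
      refine fun z hz u => ih u fun hy => h ?_
      rw [Function.iterate_succ_apply]
      refine fatten_mono.iterate k ?_ hy
      exact Finset.singleton_subset_iff.2 (mem_fatten_of_mem_nbrs (Finset.mem_singleton_self x) hz)
    have h3 : ∀ u, ∑ z ∈ nbrs x, btmRate a α x z * btmProb a α k u z y = 0 := fun u =>
      Finset.sum_eq_zero fun z hz => by rw [h2 z hz u, mul_zero]
    simp [btmProb, h1, h3]

/-- The Laplace transform `𝐄_x[exp(-τ_k)]` of the time `τ_k` of the `k`-th jump. -/
def jumpLaplace (a : ℝ) (α : Env d) : ℕ → Site d → ℝ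
  | 0, _ => 1
  | k + 1, x => (∑ z ∈ nbrs x, btmRate a α x z * jumpLaplace a α k z) / (btmExitRate a α x + 1)

lemma jumpLaplace_nonneg (k : ℕ) (x : Site d) : 0 ≤ jumpLaplace a α k x := by
  induction k generalizing x with
  | zero => exact zero_le_one
  | succ k ih =>
    have := btmExitRate_nonneg (a := a) (α := α) x
    exact div_nonneg (Finset.sum_nonneg fun z _ => mul_nonneg (btmRate_nonneg _ _) (ih z))
      (by positivity)

lemma sum_btmProb_hasDerivAt (k : ℕ) (x : Site d) (Λ : Finset (Site d)) (t : ℝ) :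
    HasDerivAt (fun t => ∑ y ∈ Λ, btmProb a α (k + 1) t x y)
      (-btmExitRate a α x * ∑ y ∈ Λ, btmProb a α (k + 1) t x y
        + ∑ z ∈ nbrs x, btmRate a α x z * ∑ y ∈ Λ, btmProb a α k t z y) t := by
  refine (HasDerivAt.fun_sum fun y _ => hasDerivAt_btmProb k x y t).congr_deriv ?_
  rw [Finset.sum_add_distrib, Finset.mul_sum, Finset.sum_comm]
  simp only [Finset.mul_sum]

lemma sum_btmProb_le_one (k : ℕ) (x : Site d) (Λ : Finset (Site d)) {t : ℝ} (ht : 0 ≤ t) :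
    ∑ y ∈ Λ, btmProb a α k t x y ≤ 1 := by
  induction k generalizing x t with
  | zero => simp [btmProb]
  | succ k ih =>
    rw [← sub_nonneg]
    refine nonneg_of_hasDerivAt (q := btmExitRate a α x)
      (E := fun t => 1 - ∑ y ∈ Λ, btmProb a α (k + 1) t x y)
      (h := fun t => ∑ z ∈ nbrs x, btmRate a α x z * (1 - ∑ y ∈ Λ, btmProb a α k t z y))
      (fun t _ => ?_) (fun t ht => ?_) ?_ ht
    · refine ((sum_btmProb_hasDerivAt k x Λ t).const_sub 1).congr_deriv ?_
      simp only [mul_sub, Finset.sum_sub_distrib, mul_one]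
      rw [show ∑ z ∈ nbrs x, btmRate a α x z = btmExitRate a α x from rfl]
      ring
    · exact Finset.sum_nonneg fun z _ => mul_nonneg (btmRate_nonneg _ _) (sub_nonneg.2 (ih z ht))
    · simp only [btmProb_succ_zero, Finset.sum_ite_eq]
      split_ifs <;> norm_num

/-- Since `Λ` contains every site reachable with fewer than `k` jumps, the left side is the
probability of `τ_k ≤ t`, and the bound is the exponential Markov inequality. It is proved by
comparison, conditioning on the first jump. -/
lemma one_sub_sum_btmProb_le (k : ℕ) (x : Site d) (Λ : Finset (Site d))
    (hΛ : fatten^[k] {x} ⊆ Λ) {t : ℝ} (ht : 0 ≤ t) :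
    1 - ∑ y ∈ Λ, btmProb a α k t x y ≤ Real.exp t * jumpLaplace a α k x := by
  induction k generalizing x t with
  | zero => simpa [btmProb, jumpLaplace] using ht
  | succ k ih =>
    have hΛ' : ∀ z ∈ nbrs x, fatten^[k] {z} ⊆ Λ := by
      refine fun z hz => subset_trans ?_ hΛ
      rw [Function.iterate_succ_apply]
      exact fatten_mono.iterate k (Finset.singleton_subset_iff.2
        (mem_fatten_of_mem_nbrs (Finset.mem_singleton_self x) hz))
    have hx : x ∈ Λ := by
      refine hΛ ?_
      by_contra h
      -- Reachability does not depend on the rates, so any environment will do: at time `0` the walk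
      -- is at `x` with probability one.
      have := btmProb_eq_zero (a := 0) (α := fun _ => 1) (k + 1) 0 h
      rw [btmProb_succ_zero, if_pos rfl] at this
      exact one_ne_zero this
    have hq : btmExitRate a α x + 1 ≠ 0 := by
      have := btmExitRate_nonneg (a := a) (α := α) x
      positivity
    have hH : (btmExitRate a α x + 1) * jumpLaplace a α (k + 1) x
        = ∑ z ∈ nbrs x, btmRate a α x z * jumpLaplace a α k z := by
      rw [jumpLaplace, mul_div_cancel₀ _ hq]
    rw [← sub_nonneg]
    refine nonneg_of_hasDerivAt (q := btmExitRate a α x)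
      (E := fun t => Real.exp t * jumpLaplace a α (k + 1) x
        - (1 - ∑ y ∈ Λ, btmProb a α (k + 1) t x y))
      (h := fun t => ∑ z ∈ nbrs x, btmRate a α x z * (Real.exp t * jumpLaplace a α k z
        - (1 - ∑ y ∈ Λ, btmProb a α k t z y)))
      (fun t _ => ?_) (fun t ht => ?_) ?_ ht
    · refine (((Real.hasDerivAt_exp t).mul_const _).sub
        ((sum_btmProb_hasDerivAt k x Λ t).const_sub 1)).congr_deriv ?_
      have e : ∑ z ∈ nbrs x, btmRate a α x z * (Real.exp t * jumpLaplace a α k z)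
          = Real.exp t * ((btmExitRate a α x + 1) * jumpLaplace a α (k + 1) x) := by
        rw [hH, Finset.mul_sum]
        exact Finset.sum_congr rfl fun _ _ => by ring
      simp only [mul_sub, Finset.sum_sub_distrib, mul_one, e]
      rw [show ∑ z ∈ nbrs x, btmRate a α x z = btmExitRate a α x from rfl]
      ring
    · exact Finset.sum_nonneg fun z hz => mul_nonneg (btmRate_nonneg _ _)
        (sub_nonneg.2 (ih z (hΛ' z hz) ht))
    · simp only [btmProb_succ_zero, Finset.sum_ite_eq, if_pos hx]
      simpa using jumpLaplace_nonneg (k + 1) x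

end Walk

/-! ### Non-explosion by a maximum principle. -/

section NonExplosion

variable {d : ℕ} {a : ℝ} {α : Env d}

/-- No infinite self-avoiding nearest-neighbour path stays in `{x | K < btmExitRate a α x}`. -/
def NoFastPath (a : ℝ) (α : Env d) (K : ℝ) : Prop :=
  ∀ γ : ℕ → Site d, Function.Injective γ → (∀ i, γ (i + 1) ∈ nbrs (γ i)) →
    ∃ i, btmExitRate a α (γ i) ≤ K

lemma jumpLaplace_succ_le (k : ℕ) (x : Site d) :
    jumpLaplace a α (k + 1) x ≤ jumpLaplace a α k x := by
  have hq := btmExitRate_nonneg (a := a) (α := α)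
  induction k generalizing x with
  | zero =>
    simp only [jumpLaplace, mul_one]
    rw [div_le_one (by have := hq x; positivity)]
    exact (lt_add_one _).le
  | succ k ih =>
    refine div_le_div_of_nonneg_right ?_ (by have := hq x; positivity)
    exact Finset.sum_le_sum fun z _ => mul_le_mul_of_nonneg_left (ih z) (btmRate_nonneg _ _)

lemma jumpLaplace_antitone (x : Site d) : Antitone fun k => jumpLaplace a α k x :=
  antitone_nat_of_succ_le fun k => jumpLaplace_succ_le k x

/-- Maximum principle: without infinite self-avoiding paths of fast sites, the walk makes finitely
many jumps in finite time. -/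
lemma tendsto_jumpLaplace {K : ℝ} (hK : NoFastPath a α K) (x : Site d) :
    Tendsto (fun k => jumpLaplace a α k x) atTop (𝓝 0) := by
  have hq := btmExitRate_nonneg (a := a) (α := α)
  -- `H` is the Laplace transform at `1` of the explosion time; the limit of the recursion is the
  -- eigenvalue equation `A H = H`.
  set H : Site d → ℝ := fun x => ⨅ k, jumpLaplace a α k x with hH
  have hlim : ∀ x, Tendsto (fun k => jumpLaplace a α k x) atTop (𝓝 (H x)) := fun x =>
    tendsto_atTop_ciInf (jumpLaplace_antitone x)
      ⟨0, by rintro _ ⟨k, rfl⟩; exact jumpLaplace_nonneg k x⟩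
  have hH0 : ∀ x, 0 ≤ H x := fun x =>
    ge_of_tendsto' (hlim x) fun k => jumpLaplace_nonneg k x
  have hH1 : ∀ x, H x ≤ 1 := fun x =>
    le_of_tendsto' (hlim x) fun k => jumpLaplace_antitone x (Nat.zero_le k)
  have hHeq : ∀ x, H x * (btmExitRate a α x + 1) = ∑ z ∈ nbrs x, btmRate a α x z * H z := by
    intro x
    have h1 : Tendsto (fun k => jumpLaplace a α (k + 1) x) atTop
        (𝓝 ((∑ z ∈ nbrs x, btmRate a α x z * H z) / (btmExitRate a α x + 1))) :=
      (tendsto_finsetSum _ fun z _ => (hlim z).const_mul _).div_const _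
    rw [tendsto_nhds_unique ((hlim x).comp (tendsto_add_atTop_nat 1)) h1,
      div_mul_cancel₀ _ (by have := hq x; positivity)]
  set M := ⨆ x, H x with hM
  have hbdd : BddAbove (Set.range H) := ⟨1, by rintro _ ⟨x, rfl⟩; exact hH1 x⟩
  have hHM : ∀ x, H x ≤ M := fun x => le_ciSup hbdd x
  set κ := max K 0 with hκ
  have hκ0 : 0 ≤ κ := le_max_right _ _
  have hM0 : 0 ≤ M := (hH0 x).trans (hHM x)
  -- At a slow site the exponential holding time costs a definite factor `q / (q + 1) ≤ κ / (κ + 1)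
  -- < 1`.
  have hslow : ∀ x, btmExitRate a α x ≤ K → H x ≤ κ / (κ + 1) * M := by
    intro x hx
    have h1 : H x * (btmExitRate a α x + 1) ≤ btmExitRate a α x * M := by
      rw [hHeq, btmExitRate, Finset.sum_mul]
      exact Finset.sum_le_sum fun z _ => mul_le_mul_of_nonneg_left (hHM z) (btmRate_nonneg _ _)
    rw [div_mul_eq_mul_div, le_div_iff₀ (by positivity)]
    have h2 : btmExitRate a α x ≤ κ := hx.trans (le_max_left _ _)
    nlinarith [hHM x, hH0 x, hq x]
  have hstep : ∀ x, 0 < H x → ∃ z ∈ nbrs x, H x < H z := by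
    intro x hx
    by_contra! hcon
    have : H x * (btmExitRate a α x + 1) ≤ btmExitRate a α x * H x := by
      rw [hHeq, btmExitRate, Finset.sum_mul]
      exact Finset.sum_le_sum fun z hz =>
        mul_le_mul_of_nonneg_left (hcon z hz) (btmRate_nonneg _ _)
    linarith
  have hall : ∀ x, H x ≤ κ / (κ + 1) * M := by
    by_contra! hcon
    obtain ⟨x₀, hx₀⟩ := hcon
    have hρ : 0 ≤ κ / (κ + 1) * M := by positivity
    -- Steepening ascent from a site above the threshold: `H` increases strictly along the path, so
    -- the path is self-avoiding and never meets a slow site, against `hK`.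
    choose! f hf hf' using hstep
    set γ : ℕ → Site d := fun i => f^[i] x₀ with hγ
    have hγs : ∀ i, γ (i + 1) = f (γ i) := fun i => Function.iterate_succ_apply' f i x₀
    have hbig : ∀ i, κ / (κ + 1) * M < H (γ i) := by
      intro i
      induction i with
      | zero => exact hx₀
      | succ i ih => rw [hγs]; exact ih.trans (hf' _ (hρ.trans_lt ih))
    have hmono : StrictMono fun i => H (γ i) :=
      strictMono_nat_of_lt_succ fun i => by
        simp only [hγs]
        exact hf' _ (hρ.trans_lt (hbig i))
    obtain ⟨i, hi⟩ := hK γ (Function.Injective.of_comp (f := H) hmono.injective) fun i => by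
      rw [hγs]; exact hf _ (hρ.trans_lt (hbig i))
    exact absurd (hslow _ hi) (not_le.2 (hbig i))
  have hMle : M ≤ κ / (κ + 1) * M := by
    have : Nonempty (Site d) := ⟨x⟩
    exact ciSup_le hall
  have hMz : M = 0 := by
    rw [div_mul_eq_mul_div, le_div_iff₀ (by positivity)] at hMle
    nlinarith
  have : H x = 0 := le_antisymm (hMz ▸ hHM x) (hH0 x)
  simpa [this] using hlim x

end NonExplosion

/-! ### Fast sites do not percolate: a union bound over chains of deep traps. -/

section Environment

/-- The sequences `[p 1, …, p m]` with `p 0 = t` and `p (i + 1) ∈ step (p i)`. -/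
def chains {T : Type*} [DecidableEq T] (step : T → Finset T) : ℕ → T → Finset (List T)
  | 0, _ => {[]}
  | m + 1, t => (step t).biUnion fun t' => (chains step m t').image (List.cons t')

lemma card_chains_le {T : Type*} [DecidableEq T] (step : T → Finset T) (D : ℕ)
    (h : ∀ t, (step t).card ≤ D) (m : ℕ) (t : T) : (chains step m t).card ≤ D ^ m := by
  induction m generalizing t with
  | zero => simp [chains]
  | succ m ih =>
    rw [chains, pow_succ']
    exact (Finset.card_biUnion_le_card_mul _ _ _ fun t' _ =>
      Finset.card_image_le.trans (ih t')).trans (Nat.mul_le_mul_right _ (h t))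

lemma map_mem_chains {T : Type*} [DecidableEq T] (step : T → Finset T) (m : ℕ) (p : ℕ → T)
    (h : ∀ i, p (i + 1) ∈ step (p i)) :
    (List.range m).map (fun i => p (i + 1)) ∈ chains step m (p 0) := by
  induction m generalizing p with
  | zero => simp [chains]
  | succ m ih =>
    rw [List.range_succ_eq_map, List.map_cons, List.map_map, chains]
    exact Finset.mem_biUnion.2 ⟨p 1, h 0, Finset.mem_image_of_mem _
      (ih (fun i => p (i + 1)) fun i => h (i + 1))⟩

variable {d : ℕ}

/-- The sites which can be reached in exactly three nearest-neighbour steps. -/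
def threeSteps (x : Site d) : Finset (Site d) := ((nbrs x).biUnion nbrs).biUnion nbrs

lemma card_threeSteps_le (x : Site d) : (threeSteps x).card ≤ (2 * d) ^ 3 := by
  have h : ∀ S : Finset (Site d), (S.biUnion nbrs).card ≤ S.card * (2 * d) := fun S =>
    Finset.card_biUnion_le_card_mul _ _ _ fun x _ => card_nbrs_le x
  calc _ ≤ ((nbrs x).card * (2 * d)) * (2 * d) :=
        (h _).trans (Nat.mul_le_mul_right _ (h _))
    _ ≤ (2 * d * (2 * d)) * (2 * d) := by gcongr; exact card_nbrs_le x
    _ = _ := by ring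

/-- If every infinite self-avoiding path had to be fast, deep traps would have to accumulate along
a chain of bounded steps. -/
lemma exists_chain_of_not_noFastPath {a : ℝ} (ha : a ∈ Set.Icc (0 : ℝ) 1) {α : Env d} {K : ℕ}
    (hK : ¬ NoFastPath a α (2 * d * (K : ℝ) ^ a)) :
    ∃ y₀ : Site d, ∀ m, ∃ l ∈ chains threeSteps m y₀,
      m ≤ l.toFinset.card * (2 * d) ∧ ∀ y ∈ l, K < (α y : ℕ) := by
  simp only [NoFastPath, not_forall, not_exists, not_le] at hK
  obtain ⟨γ, hinj, hγ, hfast⟩ := hK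
  -- As `a ≤ 1`, the factor `α_x^(a-1)` is at most one, so the rate to `y` is at most `α_y^a`; an
  -- exit rate above `2 d K^a` requires a neighbour deeper than `K`.
  have hdeep : ∀ i, ∃ y ∈ nbrs (γ i), K < (α y : ℕ) := by
    intro i
    by_contra! hcon
    refine absurd (hfast i) (not_lt.2 ?_)
    have h1 : ∀ y ∈ nbrs (γ i), btmRate a α (γ i) y ≤ (K : ℝ) ^ a := by
      intro y hy
      have h2 : (α (γ i) : ℝ) ^ (a - 1) ≤ 1 :=
        Real.rpow_le_one_of_one_le_of_nonpos (by exact_mod_cast (α (γ i)).pos)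
          (by linarith [ha.2])
      have h3 : (α y : ℝ) ^ a ≤ (K : ℝ) ^ a :=
        Real.rpow_le_rpow (env_pos α y).le (by exact_mod_cast hcon y hy) ha.1
      calc btmRate a α (γ i) y ≤ 1 * (K : ℝ) ^ a :=
            mul_le_mul h2 h3 (Real.rpow_nonneg (env_pos α y).le _) zero_le_one
        _ = _ := one_mul _
    calc btmExitRate a α (γ i) ≤ (nbrs (γ i)).card • (K : ℝ) ^ a :=
          Finset.sum_le_card_nsmul _ _ _ h1
      _ = ((nbrs (γ i)).card : ℝ) * (K : ℝ) ^ a := nsmul_eq_mul _ _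
      _ ≤ 2 * d * (K : ℝ) ^ a := by
        gcongr
        exact_mod_cast card_nbrs_le (γ i)
  choose y hy hyK using hdeep
  refine ⟨y 0, fun m => ⟨_, map_mem_chains threeSteps m y fun i => ?_, ?_, ?_⟩⟩
  -- The three steps are `y i → γ i → γ (i + 1) → y (i + 1)`.
  · exact Finset.mem_biUnion.2 ⟨γ (i + 1), Finset.mem_biUnion.2
      ⟨γ i, mem_nbrs_comm.1 (hy i), hγ i⟩, hy (i + 1)⟩
  -- The traps may repeat, but each is adjacent to at most `2 d` of the `m` distinct path sites, so
  -- at least `m / (2 d)` of them are distinct.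
  · set Y := ((List.range m).map fun i => y (i + 1)).toFinset with hY
    have hsub : (Finset.range m).image (fun i => γ (i + 1)) ⊆ Y.biUnion nbrs := by
      intro x hx
      obtain ⟨i, hi, rfl⟩ := Finset.mem_image.1 hx
      refine Finset.mem_biUnion.2 ⟨y (i + 1), ?_, mem_nbrs_comm.1 (hy _)⟩
      rw [hY, List.mem_toFinset]
      exact List.mem_map_of_mem (List.mem_range.2 (Finset.mem_range.1 hi))
    have hcard := Finset.card_le_card hsub
    rw [Finset.card_image_of_injective _ fun i j h => Nat.succ_injective (hinj h),
      Finset.card_range] at hcard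
    exact hcard.trans (Finset.card_biUnion_le_card_mul _ _ _ fun x _ => card_nbrs_le x)
  · intro z hz
    obtain ⟨i, -, rfl⟩ := List.mem_map.1 hz
    exact hyK _

lemma envLaw_deep (ν : Measure ℕ+) [IsProbabilityMeasure ν] (K : ℕ) (F : Finset (Site d)) :
    envLaw d ν {α | ∀ y ∈ F, K < (α y : ℕ)} = ν {k | K < (k : ℕ)} ^ F.card := by
  have : {α : Env d | ∀ y ∈ F, K < (α y : ℕ)}
      = Set.pi (F : Set (Site d)) fun _ => {k : ℕ+ | K < (k : ℕ)} := by
    ext α; simp [Set.mem_pi]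
  rw [this, envLaw, Measure.infinitePi_pi _ fun _ _ => MeasurableSet.of_discrete]
  simp

/-- For almost every environment the fast sites do not percolate. -/
lemma ae_exists_noFastPath (hd : 1 ≤ d) {a : ℝ} (ha : a ∈ Set.Icc (0 : ℝ) 1) (ν : Measure ℕ+)
    [IsProbabilityMeasure ν] : ∀ᵐ α ∂(envLaw d ν), ∃ K, NoFastPath a α K := by
  have hlim : Tendsto (fun K : ℕ => ν {k : ℕ+ | K < (k : ℕ)}) atTop (𝓝 0) := by
    have h0 : (⋂ K : ℕ, {k : ℕ+ | K < (k : ℕ)}) = ∅ := by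
      ext k
      simp only [Set.mem_iInter, Set.mem_ofPred_eq, Set.mem_empty_iff_false, iff_false, not_forall]
      exact ⟨k, lt_irrefl _⟩
    have := tendsto_measure_iInter_atTop (μ := ν) (s := fun K : ℕ => {k : ℕ+ | K < (k : ℕ)})
      (fun _ => MeasurableSet.of_discrete.nullMeasurableSet)
      (fun K L hKL k hk => lt_of_le_of_lt hKL hk) ⟨0, measure_ne_top _ _⟩
    rwa [h0, measure_empty] at this
  set D : ℕ := (2 * d) ^ 3 with hD
  have hD0 : (D : ℝ≥0∞) ^ (2 * d) ≠ 0 := by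
    simp [hD]
  have hDt : (D : ℝ≥0∞) ^ (2 * d) ≠ ∞ := by
    exact ENNReal.pow_ne_top (ENNReal.natCast_ne_top _)
  -- There are at most `D^(2dj)` chains of length `2 d j`, and by independence one with `j` distinct
  -- sites is entirely deep with probability at most `ρ^j`. This `K` makes the product at most
  -- `2^(-j)`.
  obtain ⟨K, hK⟩ : ∃ K : ℕ, (D : ℝ≥0∞) ^ (2 * d) * ν {k : ℕ+ | K < (k : ℕ)} < 2⁻¹ := by
    have h1 := ENNReal.Tendsto.const_mul hlim (a := (D : ℝ≥0∞) ^ (2 * d)) (.inr hDt)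
    rw [mul_zero] at h1
    exact (h1.eventually (gt_mem_nhds (by simp))).exists
  set ρ := ν {k : ℕ+ | K < (k : ℕ)} with hρ
  have hρ1 : ρ ≤ 1 := prob_le_one
  set B : Site d → ℕ → Set (Env d) := fun y₀ j =>
    ⋃ l ∈ (chains threeSteps (2 * d * j) y₀).filter fun l => j ≤ l.toFinset.card,
      {α | ∀ y ∈ l.toFinset, K < (α y : ℕ)} with hB
  have hBle : ∀ y₀ j, envLaw d ν (B y₀ j) ≤ 2⁻¹ ^ j := by
    intro y₀ j
    calc envLaw d ν (B y₀ j)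
        ≤ ∑ l ∈ (chains threeSteps (2 * d * j) y₀).filter fun l => j ≤ l.toFinset.card,
            envLaw d ν {α | ∀ y ∈ l.toFinset, K < (α y : ℕ)} := measure_biUnion_finset_le _ _
      _ ≤ ∑ l ∈ (chains threeSteps (2 * d * j) y₀).filter fun l => j ≤ l.toFinset.card, ρ ^ j := by
          refine Finset.sum_le_sum fun l hl => ?_
          rw [envLaw_deep]
          exact pow_le_pow_right_of_le_one' hρ1 (Finset.mem_filter.1 hl).2
      _ ≤ ((D ^ (2 * d * j) : ℕ) : ℝ≥0∞) * ρ ^ j := by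
          rw [Finset.sum_const, nsmul_eq_mul]
          gcongr
          exact (Finset.card_filter_le _ _).trans (card_chains_le _ _ card_threeSteps_le _ _)
      _ = ((D : ℝ≥0∞) ^ (2 * d) * ρ) ^ j := by
          rw [mul_pow, pow_mul]; push_cast; rfl
      _ ≤ 2⁻¹ ^ j := by gcongr
  have hnull : ∀ y₀, envLaw d ν (⋂ j, B y₀ j) = 0 := by
    intro y₀
    have h1 : Tendsto (fun j : ℕ => (2⁻¹ : ℝ≥0∞) ^ j) atTop (𝓝 0) :=
      ENNReal.tendsto_pow_atTop_nhds_zero_of_lt_one (by simp)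
    exact le_antisymm (ge_of_tendsto' h1 fun j =>
      (measure_mono (Set.iInter_subset _ j)).trans (hBle y₀ j)) zero_le
  have hall : ∀ᵐ α ∂(envLaw d ν), ∀ y₀, α ∉ ⋂ j, B y₀ j :=
    ae_all_iff.2 fun y₀ => measure_eq_zero_iff_ae_notMem.1 (hnull y₀)
  filter_upwards [hall] with α hα
  refine ⟨2 * d * (K : ℝ) ^ a, ?_⟩
  by_contra hcon
  obtain ⟨y₀, h⟩ := exists_chain_of_not_noFastPath ha hcon
  refine hα y₀ (Set.mem_iInter.2 fun j => ?_)
  obtain ⟨l, hl, hlc, hlK⟩ := h (2 * d * j)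
  refine Set.mem_iUnion₂.2 ⟨l, Finset.mem_filter.2 ⟨hl, ?_⟩, by simpa using hlK⟩
  rw [mul_comm] at hlc
  exact Nat.le_of_mul_le_mul_right hlc (by omega)

end Environment

/-! ### The exclusion generator on local functions, linear functionals and their squares. -/

section Generator

variable {d : ℕ} {a : ℝ} {α : Env d}

/-- The rate at which the exclusion process in the configuration `η` moves a particle from `x`
to `y`. -/
def exclRate (a : ℝ) (α : Env d) (η : Config α) (x y : Site d) : ℝ :=
  ((η x : ℕ) : ℝ) * (α x : ℝ) ^ (a - 1) * ((α y : ℝ) ^ a * (1 - ((η y : ℕ) : ℝ) / (α y : ℝ)))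

lemma config_le (η : Config α) (x : Site d) : ((η x : ℕ) : ℝ) ≤ α x := by
  exact_mod_cast Nat.lt_succ_iff.1 (η x).isLt

/-- Splits off the interaction term, which is symmetric in `x` and `y` and so cancels against any
antisymmetric increment. -/
lemma exclRate_eq (η : Config α) (x y : Site d) :
    exclRate a α η x y = ((η x : ℕ) : ℝ) * btmRate a α x y
      - ((η x : ℕ) : ℝ) * ((η y : ℕ) : ℝ) * ((α x : ℝ) ^ (a - 1) * (α y : ℝ) ^ (a - 1)) := by
  rw [exclRate, btmRate, Real.rpow_sub_one (env_pos α y).ne']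
  ring

lemma exclRate_le (η : Config α) (x y : Site d) :
    exclRate a α η x y ≤ ((η x : ℕ) : ℝ) * btmRate a α x y := by
  have hx := Real.rpow_nonneg (env_pos α x).le (a - 1)
  have hy := Real.rpow_nonneg (env_pos α y).le (a - 1)
  rw [exclRate_eq, sub_le_self_iff]
  positivity

lemma move_apply (η : Config α) (x y z : Site d) :
    (move η x y z : ℕ) = if 0 < (η x : ℕ) ∧ (η y : ℕ) < (α y : ℕ) then
      (if z = y then (η y : ℕ) + 1 else if z = x then (η x : ℕ) - 1 else η z) else η z := by
  unfold move
  by_cases h : 0 < (η x : ℕ) ∧ (η y : ℕ) < (α y : ℕ)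
  · simp only [h, and_self, dif_pos, if_true]
    by_cases hy : z = y
    · subst hy; simp
    · by_cases hx : z = x
      · subst hx; simp [hy]
      · simp [hy, hx]
  · rw [dif_neg h, if_neg h]

/-- The rate vanishes exactly where `move` is blocked, so under the generator a jump always adds
`δ_y - δ_x`. -/
lemma exclRate_eq_zero_or_move (η : Config α) {x y : Site d} (hxy : x ≠ y) :
    exclRate a α η x y = 0 ∨ ∀ z, ((move η x y z : ℕ) : ℝ) =
      ((η z : ℕ) : ℝ) + ((if z = y then 1 else 0) - (if z = x then 1 else 0)) := by
  by_cases hx : (η x : ℕ) = 0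
  · left; simp [exclRate, hx]
  by_cases hy : (η y : ℕ) < (α y : ℕ)
  · right
    intro z
    rw [move_apply, if_pos ⟨Nat.pos_of_ne_zero hx, hy⟩]
    by_cases h1 : z = y
    · subst h1; simp [hxy.symm]
    · by_cases h2 : z = x
      · subst h2
        rw [if_neg h1, if_pos rfl, if_neg h1, if_pos rfl, Nat.cast_sub (Nat.pos_of_ne_zero hx)]
        push_cast
        ring
      · simp [h1, h2]
  · left
    have : (η y : ℕ) = α y := le_antisymm (Nat.lt_succ_iff.1 (η y).isLt) (not_lt.1 hy)
    have h : ((η y : ℕ) : ℝ) / (α y : ℝ) = 1 := by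
      rw [this]; exact div_self (env_pos α y).ne'
    simp [exclRate, h]

lemma exclGen_eq_sum {φ : Config α → ℝ} {S T : Finset (Site d)}
    (hφ : DependsOn φ (S : Set (Site d))) (hT : fatten S ⊆ T) (η : Config α) :
    exclGen a α φ η
      = ∑ x ∈ T, ∑ y ∈ nbrs x, exclRate a α η x y * (φ (move η x y) - φ η) := by
  refine tsum_eq_sum fun x hx => Finset.sum_eq_zero fun y hy => ?_
  have hxS : x ∉ S := fun h => hx (hT (subset_fatten S h))
  have hyS : y ∉ S := fun h => hx (hT (mem_fatten_of_mem_nbrs h (mem_nbrs_comm.1 hy)))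
  rw [hφ (x := move η x y) (y := η), sub_self, mul_zero]
  intro z hz
  have hzx : z ≠ x := fun h => hxS (h ▸ hz)
  have hzy : z ≠ y := fun h => hyS (h ▸ hz)
  refine Fin.ext ?_
  rw [move_apply]
  simp [hzx, hzy]

lemma IsLocal.exclGen {φ : Config α → ℝ} (hφ : IsLocal φ) : IsLocal (exclGen a α φ) := by
  obtain ⟨S, hS⟩ := hφ
  refine ⟨fatten (fatten S), fun η ζ h => ?_⟩
  rw [exclGen_eq_sum hS subset_rfl, exclGen_eq_sum hS subset_rfl]
  refine Finset.sum_congr rfl fun x hx => Finset.sum_congr rfl fun y hy => ?_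
  have hx' := h x (subset_fatten _ hx)
  have hy' := h y (mem_fatten_of_mem_nbrs hx hy)
  have h1 : φ η = φ ζ := hS fun z hz => h z (subset_fatten _ (subset_fatten _ hz))
  have h2 : φ (move η x y) = φ (move ζ x y) := by
    refine hS fun z hz => Fin.ext ?_
    rw [move_apply, move_apply, hx', hy', h z (subset_fatten _ (subset_fatten _ hz))]
  rw [h1, h2, exclRate, exclRate, hx', hy']

lemma exclGen_sum {ι : Type*} (I : Finset ι) (φ : ι → Config α → ℝ) (hφ : ∀ i, IsLocal (φ i))
    (c : ι → ℝ) (η : Config α) :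
    exclGen a α (fun ζ => ∑ i ∈ I, c i * φ i ζ) η = ∑ i ∈ I, c i * exclGen a α (φ i) η := by
  classical
  choose S hS using hφ
  set T := I.biUnion S with hT
  have h1 : ∀ i ∈ I, DependsOn (φ i) (T : Set (Site d)) := fun i hi η ζ h =>
    hS i fun z hz => h z (Finset.mem_biUnion.2 ⟨i, hi, hz⟩)
  have h2 : DependsOn (fun ζ => ∑ i ∈ I, c i * φ i ζ) (T : Set (Site d)) := fun η ζ h =>
    Finset.sum_congr rfl fun i hi => by rw [h1 i hi h]
  have h3 : ∑ i ∈ I, c i * exclGen a α (φ i) η = ∑ i ∈ I, c i *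
      ∑ x ∈ fatten T, ∑ y ∈ nbrs x, exclRate a α η x y * (φ i (move η x y) - φ i η) :=
    Finset.sum_congr rfl fun i hi => by rw [exclGen_eq_sum (h1 i hi) subset_rfl η]
  rw [exclGen_eq_sum h2 subset_rfl, h3]
  simp only [Finset.mul_sum, ← Finset.sum_sub_distrib]
  rw [Finset.sum_comm]
  refine Finset.sum_congr rfl fun x _ => ?_
  rw [Finset.sum_comm]
  exact Finset.sum_congr rfl fun y _ => Finset.sum_congr rfl fun i _ => by ring

lemma IsLocal.exists_factor {φ : Config α → ℝ} (hφ : IsLocal φ) :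
    ∃ (S : Finset (Site d)) (ψ : (∀ x : S, Fin ((α x : ℕ) + 1)) → ℝ),
      φ = fun η => ψ fun x => η x := by
  obtain ⟨S, hS⟩ := hφ
  obtain ⟨ψ, hψ⟩ := (Function.factorsThrough_iff φ).1 (dependsOn_iff_factorsThrough.1 hS)
  exact ⟨S, ψ, hψ⟩

lemma IsLocal.measurable {φ : Config α → ℝ} (hφ : IsLocal φ) : Measurable φ := by
  obtain ⟨S, ψ, rfl⟩ := hφ.exists_factor
  exact (measurable_of_countable ψ).comp (measurable_pi_lambda _ fun x => measurable_pi_apply _)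

lemma IsLocal.exists_bound {φ : Config α → ℝ} (hφ : IsLocal φ) : ∃ C, ∀ η, ‖φ η‖ ≤ C := by
  obtain ⟨S, ψ, rfl⟩ := hφ.exists_factor
  obtain ⟨C, hC⟩ := (Set.finite_range fun i => ‖ψ i‖).bddAbove
  exact ⟨C, fun η => hC ⟨_, rfl⟩⟩

/-- The pairing `∑_{x ∈ Λ} g(x) η(x)`. -/
def pairing (Λ : Finset (Site d)) (g : Site d → ℝ) (η : Config α) : ℝ :=
  ∑ x ∈ Λ, g x * ((η x : ℕ) : ℝ)

lemma isLocal_const (c : ℝ) : IsLocal fun _ : Config α => c :=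
  ⟨∅, fun _ _ _ => rfl⟩

lemma IsLocal.add {φ ψ : Config α → ℝ} (hφ : IsLocal φ) (hψ : IsLocal ψ) :
    IsLocal fun η => φ η + ψ η := by
  obtain ⟨S, hS⟩ := hφ
  obtain ⟨T, hT⟩ := hψ
  refine ⟨S ∪ T, fun η ζ h => ?_⟩
  simp only
  rw [hS fun x hx => h x (Finset.mem_union_left _ hx),
    hT fun x hx => h x (Finset.mem_union_right _ hx)]

lemma IsLocal.mul {φ ψ : Config α → ℝ} (hφ : IsLocal φ) (hψ : IsLocal ψ) :
    IsLocal fun η => φ η * ψ η := by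
  obtain ⟨S, hS⟩ := hφ
  obtain ⟨T, hT⟩ := hψ
  refine ⟨S ∪ T, fun η ζ h => ?_⟩
  simp only
  rw [hS fun x hx => h x (Finset.mem_union_left _ hx),
    hT fun x hx => h x (Finset.mem_union_right _ hx)]

lemma isLocal_coord (x : Site d) : IsLocal fun η : Config α => ((η x : ℕ) : ℝ) :=
  ⟨{x}, fun η ζ h => by simp [h x]⟩

lemma isLocal_coord_mul (x y : Site d) :
    IsLocal fun η : Config α => ((η x : ℕ) : ℝ) * ((η y : ℕ) : ℝ) :=
  (isLocal_coord x).mul (isLocal_coord y)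

lemma dependsOn_pairing (Λ : Finset (Site d)) (g : Site d → ℝ) :
    DependsOn (pairing (α := α) Λ g) (Λ : Set (Site d)) := fun η ζ h =>
  Finset.sum_congr rfl fun x hx => by rw [h x hx]

lemma isLocal_pairing (Λ : Finset (Site d)) (g : Site d → ℝ) : IsLocal (pairing (α := α) Λ g) :=
  ⟨Λ, dependsOn_pairing Λ g⟩

lemma isLocal_pairing_sq (Λ : Finset (Site d)) (g : Site d → ℝ) :
    IsLocal fun η => pairing (α := α) Λ g η ^ 2 := by
  simpa only [pow_two] using (isLocal_pairing Λ g).mul (isLocal_pairing Λ g)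

lemma pairing_nonneg {Λ : Finset (Site d)} {g : Site d → ℝ} (hg : ∀ x, 0 ≤ g x) (η : Config α) :
    0 ≤ pairing Λ g η :=
  Finset.sum_nonneg fun x _ => mul_nonneg (hg x) (Nat.cast_nonneg _)

lemma pairing_mono {Λ : Finset (Site d)} {g h : Site d → ℝ} (hgh : ∀ x ∈ Λ, g x ≤ h x)
    (η : Config α) : pairing Λ g η ≤ pairing Λ h η :=
  Finset.sum_le_sum fun x hx => mul_le_mul_of_nonneg_right (hgh x hx) (Nat.cast_nonneg _)

lemma pairing_le {Λ : Finset (Site d)} {g : Site d → ℝ} (hg : ∀ x, 0 ≤ g x) (η : Config α) :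
    pairing Λ g η ≤ ∑ x ∈ Λ, g x * α x :=
  Finset.sum_le_sum fun x _ => mul_le_mul_of_nonneg_left (config_le η x) (hg x)

lemma exclRate_mul_move {Λ : Finset (Site d)} {g : Site d → ℝ} (hg : ∀ x ∉ Λ, g x = 0)
    (F : ℝ → ℝ) (η : Config α) {x y : Site d} (hy : y ∈ nbrs x) :
    exclRate a α η x y * (F (pairing Λ g (move η x y)) - F (pairing Λ g η))
      = exclRate a α η x y * (F (pairing Λ g η + (g y - g x)) - F (pairing Λ g η)) := by
  obtain h | h := exclRate_eq_zero_or_move (a := a) η (ne_of_mem_nbrs hy)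
  · simp [h]
  · have e : ∀ x, (if x ∈ Λ then g x else 0) = g x := fun x => by
      split_ifs with hx
      · rfl
      · exact (hg x hx).symm
    have : pairing Λ g (move η x y) = pairing Λ g η + (g y - g x) := by
      simp only [pairing, h, mul_add, mul_sub, Finset.sum_add_distrib, Finset.sum_sub_distrib,
        mul_ite, mul_one, mul_zero, Finset.sum_ite_eq', e]
    rw [this]

/-- All edges touching `Λ` have both endpoints in `fatten Λ`, so the two orientations cancel there.
This serves for the exclusion term and again for conservation of `α`-mass. -/
lemma sum_nbrs_eq_zero_of_antisymm {Λ : Finset (Site d)} {A : Site d → Site d → ℝ}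
    (hA : ∀ x y, A y x = -A x y) (h0 : ∀ x y, x ∉ Λ → y ∉ Λ → A x y = 0) :
    ∑ x ∈ fatten Λ, ∑ y ∈ nbrs x, A x y = 0 := by
  have h1 : ∀ x, ∑ y ∈ nbrs x, A x y
      = ∑ y ∈ fatten Λ, if y ∈ nbrs x then A x y else 0 := by
    intro x
    rw [← Finset.sum_filter, Finset.filter_mem_eq_inter, Finset.inter_comm]
    refine (Finset.sum_subset Finset.inter_subset_left fun y hy hy' => ?_).symm
    have hyT : y ∉ fatten Λ := fun h => hy' (Finset.mem_inter.2 ⟨hy, h⟩)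
    exact h0 x y (fun h => hyT (mem_fatten_of_mem_nbrs h hy)) fun h => hyT (subset_fatten _ h)
  simp only [h1]
  have h2 : ∑ x ∈ fatten Λ, ∑ y ∈ fatten Λ, (if y ∈ nbrs x then A x y else 0)
      = -∑ x ∈ fatten Λ, ∑ y ∈ fatten Λ, if y ∈ nbrs x then A x y else 0 := by
    conv_lhs => rw [Finset.sum_comm]
    simp only [← Finset.sum_neg_distrib]
    refine Finset.sum_congr rfl fun x _ => Finset.sum_congr rfl fun y _ => ?_
    simp only [mem_nbrs_comm (x := y) (y := x), hA x y]
    split_ifs <;> simp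
  linarith

/-- The generator acting on linear functionals: the exclusion interaction cancels. -/
lemma sum_exclRate_mul_sub {Λ : Finset (Site d)} {g : Site d → ℝ} (hg : ∀ x ∉ Λ, g x = 0)
    (η : Config α) :
    ∑ x ∈ fatten Λ, ∑ y ∈ nbrs x, exclRate a α η x y * (g y - g x)
      = pairing (fatten Λ) (fun x => ∑ y ∈ nbrs x, btmRate a α x y * (g y - g x)) η := by
  have h := sum_nbrs_eq_zero_of_antisymm (Λ := Λ) (A := fun x y =>
    ((η x : ℕ) : ℝ) * ((η y : ℕ) : ℝ) * ((α x : ℝ) ^ (a - 1) * (α y : ℝ) ^ (a - 1))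
      * (g y - g x)) (fun x y => by ring) (fun x y hx hy => by simp [hg x hx, hg y hy])
  simp only [exclRate_eq, sub_mul _ _ (g _ - g _), Finset.sum_sub_distrib] at h ⊢
  rw [h, sub_zero, pairing]
  refine Finset.sum_congr rfl fun x _ => ?_
  rw [Finset.sum_mul]
  exact Finset.sum_congr rfl fun y _ => by ring

lemma exclGen_pairing {Λ : Finset (Site d)} {g : Site d → ℝ} (hg : ∀ x ∉ Λ, g x = 0)
    (η : Config α) :
    exclGen a α (pairing Λ g) η
      = pairing (fatten Λ) (fun x => ∑ y ∈ nbrs x, btmRate a α x y * (g y - g x)) η := by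
  rw [exclGen_eq_sum (dependsOn_pairing Λ g) subset_rfl, ← sum_exclRate_mul_sub hg]
  refine Finset.sum_congr rfl fun x _ => Finset.sum_congr rfl fun y hy => ?_
  rw [exclRate_mul_move hg (fun u => u) η hy]
  ring

/-- A jump changes `u²` by `2uδ + δ²`. The first part reproduces the linear action exactly; in the
second, `exclRate_le` replaces the exclusion rate by the free one. -/
lemma exclGen_pairing_sq_le {Λ : Finset (Site d)} {g : Site d → ℝ} (hg : ∀ x ∉ Λ, g x = 0)
    (η : Config α) :
    exclGen a α (fun ζ => pairing Λ g ζ ^ 2) η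
      ≤ 2 * pairing Λ g η * exclGen a α (pairing Λ g) η
        + pairing (fatten Λ) (fun x => ∑ y ∈ nbrs x, btmRate a α x y * (g y - g x) ^ 2) η := by
  have hdep : DependsOn (fun ζ => pairing (α := α) Λ g ζ ^ 2) (Λ : Set (Site d)) :=
    fun _ _ h => congrArg (· ^ 2) (dependsOn_pairing Λ g h)
  have h1 : pairing (fatten Λ) (fun x => ∑ y ∈ nbrs x, btmRate a α x y * (g y - g x) ^ 2) η
      = ∑ x ∈ fatten Λ, ∑ y ∈ nbrs x, ((η x : ℕ) : ℝ) * btmRate a α x y * (g y - g x) ^ 2 := by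
    simp only [pairing, Finset.sum_mul]
    exact Finset.sum_congr rfl fun x _ => Finset.sum_congr rfl fun y _ => by ring
  rw [exclGen_eq_sum hdep subset_rfl, exclGen_pairing hg, ← sum_exclRate_mul_sub hg, h1]
  simp only [Finset.mul_sum, ← Finset.sum_add_distrib]
  refine Finset.sum_le_sum fun x _ => Finset.sum_le_sum fun y hy => ?_
  rw [exclRate_mul_move hg (fun u => u ^ 2) η hy]
  have := mul_le_mul_of_nonneg_right (exclRate_le (a := a) η x y) (sq_nonneg (g y - g x))
  linarith

end Generator

/-! ### Dynkin's formula for the exclusion process. -/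

section Dynamics

variable {d : ℕ} {a : ℝ} {α : Env d} {η : Config α} {Ω : Type*} {mΩ : MeasurableSpace Ω}
  {P : Measure Ω} {ξ : ℝ≥0 → Ω → Config α}

lemma IsExclusionProcess.measurable (h : IsExclusionProcess a α η P ξ) (t : ℝ≥0) :
    Measurable (ξ t) := by
  obtain ⟨ℱ, hℱ, -⟩ := h.martingale_problem
  exact (hℱ t).mono (ℱ.le t) le_rfl

/-- Decreasing-to-`s` grid times `(⌊(n + 1) s⌋ + 1) / (n + 1)`. -/
lemma tendsto_gridTime (s : ℝ≥0) :
    Tendsto (fun n : ℕ => ((⌊((n : ℝ≥0) + 1) * s⌋₊ : ℝ≥0) + 1) / ((n : ℝ≥0) + 1)) atTop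
      (𝓝[≥] s) := by
  have hle : ∀ n : ℕ, s ≤ ((⌊((n : ℝ≥0) + 1) * s⌋₊ : ℝ≥0) + 1) / ((n : ℝ≥0) + 1) := fun n => by
    rw [le_div_iff₀ (by positivity), mul_comm]
    exact (Nat.lt_floor_add_one _).le
  have hge : ∀ n : ℕ, ((⌊((n : ℝ≥0) + 1) * s⌋₊ : ℝ≥0) + 1) / ((n : ℝ≥0) + 1)
      ≤ s + 1 / ((n : ℝ≥0) + 1) := fun n => by
    rw [add_div]
    gcongr
    rw [div_le_iff₀ (by positivity), mul_comm s]
    exact Nat.floor_le zero_le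
  refine tendsto_nhdsWithin_iff.2 ⟨?_, Eventually.of_forall hle⟩
  refine tendsto_of_tendsto_of_tendsto_of_le_of_le tendsto_const_nhds ?_ hle hge
  simpa using tendsto_const_nhds.add (tendsto_one_div_add_atTop_nhds_zero_nat (𝕜 := ℝ≥0))

/-- Right-continuity makes the process the pointwise limit of its values at grid times to the right.
Joint measurability is what Fubini needs in Dynkin's formula. -/
lemma IsExclusionProcess.measurable_uncurry (h : IsExclusionProcess a α η P ξ) :
    Measurable fun p : ℝ≥0 × Ω => ξ p.1 p.2 := by
  have h1 : ∀ n : ℕ, Measurable fun p : ℕ × Ω => ξ (((p.1 : ℝ≥0) + 1) / ((n : ℝ≥0) + 1)) p.2 :=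
    fun n => measurable_from_prod_countable_right fun k =>
      h.measurable (((k : ℝ≥0) + 1) / ((n : ℝ≥0) + 1))
  have h2 : ∀ n : ℕ, Measurable fun p : ℝ≥0 × Ω => (⌊((n : ℝ≥0) + 1) * p.1⌋₊, p.2) := fun n =>
    (Nat.measurable_floor.comp (measurable_fst.const_mul _)).prodMk measurable_snd
  exact measurable_of_tendsto_metrizable (fun n => (h1 n).comp (h2 n))
    (tendsto_pi_nhds.2 fun p => (h.right_continuous p.2 p.1).tendsto.comp (tendsto_gridTime p.1))

/-- The expectation of a local function at time `s`, with time clamped to `[0, ∞)`. -/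
def expect (P : Measure Ω) (ξ : ℝ≥0 → Ω → Config α) (φ : Config α → ℝ) (s : ℝ) : ℝ :=
  ∫ ω, φ (ξ s.toNNReal ω) ∂P

variable [IsProbabilityMeasure P]

lemma IsExclusionProcess.integrable (h : IsExclusionProcess a α η P ξ) {φ : Config α → ℝ}
    (hφ : IsLocal φ) (t : ℝ≥0) : Integrable (fun ω => φ (ξ t ω)) P := by
  obtain ⟨C, hC⟩ := hφ.exists_bound
  exact .of_bound (hφ.measurable.comp (h.measurable t)).aestronglyMeasurable C
    (ae_of_all _ fun ω => hC _)

lemma IsExclusionProcess.expect_zero (h : IsExclusionProcess a α η P ξ) (φ : Config α → ℝ) :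
    expect P ξ φ 0 = φ η := by
  have : ∫ ω, φ (ξ (0 : ℝ).toNNReal ω) ∂P = ∫ _, φ η ∂P := by
    rw [Real.toNNReal_zero]
    exact integral_congr_ae (h.initial.mono fun ω hω => by simp only [hω])
  simpa [expect] using this

lemma IsExclusionProcess.measurable_expect (h : IsExclusionProcess a α η P ξ) {φ : Config α → ℝ}
    (hφ : IsLocal φ) : StronglyMeasurable (expect P ξ φ) := by
  have : Measurable fun p : ℝ × Ω => φ (ξ p.1.toNNReal p.2) :=
    hφ.measurable.comp (h.measurable_uncurry.comp
      ((measurable_real_toNNReal.comp measurable_fst).prodMk measurable_snd))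
  exact this.stronglyMeasurable.integral_prod_right

lemma IsExclusionProcess.intervalIntegrable_expect (h : IsExclusionProcess a α η P ξ)
    {φ : Config α → ℝ} (hφ : IsLocal φ) (s t : ℝ) :
    IntervalIntegrable (expect P ξ φ) volume s t := by
  obtain ⟨C, hC⟩ := hφ.exists_bound
  refine (intervalIntegrable_const (c := C)).mono_fun
    (h.measurable_expect hφ).aestronglyMeasurable (ae_of_all _ fun s => ?_)
  refine (norm_integral_le_of_norm_le_const (ae_of_all _ fun ω => hC _)).trans ?_
  simpa using le_abs_self C

/-- Dynkin's formula. -/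
lemma IsExclusionProcess.expect_eq (h : IsExclusionProcess a α η P ξ) {φ : Config α → ℝ}
    (hφ : IsLocal φ) {t : ℝ} (ht : 0 ≤ t) :
    expect P ξ φ t = φ η + ∫ s in (0 : ℝ)..t, expect P ξ (exclGen a α φ) s := by
  obtain ⟨ℱ, hℱ, hM⟩ := h.martingale_problem
  have hψ : IsLocal (exclGen a α φ) := hφ.exclGen
  obtain ⟨C, hC⟩ := hψ.exists_bound
  lift t to ℝ≥0 using ht
  have hjoint : Integrable (Function.uncurry fun (s : ℝ) ω => exclGen a α φ (ξ s.toNNReal ω))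
      ((volume.restrict (Set.Ioc 0 (t : ℝ))).prod P) := by
    refine .of_bound (Measurable.aestronglyMeasurable ?_) C (ae_of_all _ fun p => hC _)
    exact hψ.measurable.comp (h.measurable_uncurry.comp
      ((measurable_real_toNNReal.comp measurable_fst).prodMk measurable_snd))
  have hmart := hM φ hφ
  have h0 : ∫ ω, (φ (ξ t ω) - φ (ξ 0 ω)
      - ∫ s in (0 : ℝ)..t, exclGen a α φ (ξ s.toNNReal ω)) ∂P = 0 := by
    rw [← integral_condExp (ℱ.le 0), integral_congr_ae (hmart.2 0 t zero_le)]
    simp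
  simp only [intervalIntegral.integral_of_le t.coe_nonneg] at h0 ⊢
  have hint : Integrable (fun ω => ∫ s in Set.Ioc 0 (t : ℝ),
      exclGen a α φ (ξ s.toNNReal ω)) P := hjoint.integral_prod_right
  have hdiff : Integrable (fun ω => φ (ξ t ω) - φ (ξ 0 ω)) P :=
    (h.integrable hφ t).sub (h.integrable hφ 0)
  rw [integral_sub hdiff hint, integral_sub (h.integrable hφ t) (h.integrable hφ 0),
    ← integral_integral_swap hjoint] at h0
  have h1 := h.expect_zero φ
  simp only [expect, Real.toNNReal_zero, Real.toNNReal_coe] at h1 ⊢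
  linarith

lemma IsExclusionProcess.continuous_expect (h : IsExclusionProcess a α η P ξ) {φ : Config α → ℝ}
    (hφ : IsLocal φ) : Continuous (expect P ξ φ) := by
  have h1 := intervalIntegral.continuous_primitive
    (h.intervalIntegrable_expect (hφ.exclGen (a := a))) 0
  have h2 : expect P ξ φ = fun t => φ η + ∫ s in (0 : ℝ)..(max t 0),
      expect P ξ (BouchaudExclusion.exclGen a α φ) s := by
    funext t
    rw [← h.expect_eq hφ (le_max_right t 0), expect, expect]
    congr 3
    simp [Real.toNNReal]
  rw [h2]
  exact continuous_const.add (h1.comp (continuous_id.max continuous_const))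

lemma IsExclusionProcess.hasDerivAt_expect (h : IsExclusionProcess a α η P ξ) {φ : Config α → ℝ}
    (hφ : IsLocal φ) {t : ℝ} (ht : 0 < t) :
    HasDerivAt (expect P ξ φ) (expect P ξ (exclGen a α φ) t) t := by
  have hc := h.continuous_expect (hφ.exclGen (a := a))
  have h1 := (intervalIntegral.integral_hasDerivAt_right (hc.intervalIntegrable 0 t)
    (hc.stronglyMeasurableAtFilter _ _) hc.continuousAt).const_add (φ η)
  refine h1.congr_of_eventuallyEq ?_
  filter_upwards [lt_mem_nhds ht] with s hs using h.expect_eq hφ hs.le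

lemma IsExclusionProcess.expect_sum (h : IsExclusionProcess a α η P ξ) {ι : Type*} (I : Finset ι)
    {φ : ι → Config α → ℝ} (hφ : ∀ i, IsLocal (φ i)) (c : ι → ℝ) (s : ℝ) :
    expect P ξ (fun ζ => ∑ i ∈ I, c i * φ i ζ) s = ∑ i ∈ I, c i * expect P ξ (φ i) s := by
  simp only [expect]
  rw [integral_finsetSum _ fun i _ => (h.integrable (hφ i) _).const_mul _]
  simp only [integral_const_mul]

/-- Dynkin's formula for time-dependent combinations of local functions. -/
lemma IsExclusionProcess.hasDerivAt_expect_sum (h : IsExclusionProcess a α η P ξ) {ι : Type*}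
    (I : Finset ι) {φ : ι → Config α → ℝ} (hφ : ∀ i, IsLocal (φ i)) {c : ι → ℝ → ℝ} {c' : ι → ℝ}
    {t : ℝ} (ht : 0 < t) (hc : ∀ i, HasDerivAt (c i) (c' i) t) :
    HasDerivAt (fun s => expect P ξ (fun ζ => ∑ i ∈ I, c i s * φ i ζ) s)
      (expect P ξ (fun ζ => ∑ i ∈ I, c' i * φ i ζ) t
        + expect P ξ (exclGen a α fun ζ => ∑ i ∈ I, c i t * φ i ζ) t) t := by
  have e : exclGen a α (fun ζ => ∑ i ∈ I, c i t * φ i ζ)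
      = fun ζ => ∑ i ∈ I, c i t * exclGen a α (φ i) ζ := funext fun ζ => exclGen_sum I φ hφ _ ζ
  rw [e, h.expect_sum I hφ, h.expect_sum I fun i => (hφ i).exclGen, ← Finset.sum_add_distrib]
  simp only [h.expect_sum I hφ]
  exact HasDerivAt.fun_sum fun i _ => (hc i).fun_mul (h.hasDerivAt_expect (hφ i) ht)

lemma IsExclusionProcess.continuous_expect_sum (h : IsExclusionProcess a α η P ξ) {ι : Type*}
    (I : Finset ι) {φ : ι → Config α → ℝ} (hφ : ∀ i, IsLocal (φ i)) {c : ι → ℝ → ℝ}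
    (hc : ∀ i, Continuous (c i)) :
    Continuous fun s => expect P ξ (fun ζ => ∑ i ∈ I, c i s * φ i ζ) s := by
  simp only [h.expect_sum I hφ]
  exact continuous_finsetSum _ fun i _ => (hc i).mul (h.continuous_expect (hφ i))

end Dynamics

/-! ### The semigroup truncated by the number of jumps. -/

section TruncatedSemigroup

variable {d : ℕ} {a : ℝ} {α : Env d}

/-- The semigroup of `BTM(a)` truncated by the number of jumps, acting on functions carried by a
finite set `S`. -/
def truncSemigroup (a : ℝ) (α : Env d) (S : Finset (Site d)) (f : Site d → ℝ) (k : ℕ) (t : ℝ)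
    (x : Site d) : ℝ :=
  ∑ y ∈ S, btmProb a α k t x y * f y

variable {S : Finset (Site d)} {f : Site d → ℝ}

lemma truncSemigroup_nonneg (hf : ∀ x, 0 ≤ f x) (k : ℕ) {t : ℝ} (ht : 0 ≤ t) (x : Site d) :
    0 ≤ truncSemigroup a α S f k t x :=
  Finset.sum_nonneg fun y _ => mul_nonneg (btmProb_nonneg k x y ht) (hf y)

lemma truncSemigroup_le_succ (hf : ∀ x, 0 ≤ f x) (k : ℕ) {t : ℝ} (ht : 0 ≤ t) (x : Site d) :
    truncSemigroup a α S f k t x ≤ truncSemigroup a α S f (k + 1) t x :=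
  Finset.sum_le_sum fun y _ => mul_le_mul_of_nonneg_right (btmProb_le_succ k x y ht) (hf y)

lemma continuous_truncSemigroup (k : ℕ) (x : Site d) :
    Continuous fun t => truncSemigroup a α S f k t x :=
  continuous_finsetSum _ fun y _ => (continuous_btmProb k x y).mul continuous_const

lemma hasDerivAt_truncSemigroup (k : ℕ) (x : Site d) (t : ℝ) :
    HasDerivAt (fun t => truncSemigroup a α S f (k + 1) t x)
      (∑ z ∈ nbrs x, btmRate a α x z *
        (truncSemigroup a α S f k t z - truncSemigroup a α S f (k + 1) t x)) t := by
  refine (HasDerivAt.fun_sum fun y _ => (hasDerivAt_btmProb k x y t).mul_const (f y)).congr_deriv ?_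
  simp only [add_mul, Finset.sum_add_distrib, mul_sub, Finset.sum_sub_distrib, ← Finset.sum_mul,
    truncSemigroup]
  rw [show ∑ z ∈ nbrs x, btmRate a α x z = btmExitRate a α x from rfl]
  simp only [Finset.sum_mul, Finset.mul_sum]
  rw [Finset.sum_comm]
  simp only [mul_assoc, neg_mul, Finset.sum_neg_distrib]
  ring

lemma truncSemigroup_zero (hfS : ∀ x ∉ S, f x = 0) (k : ℕ) (x : Site d) :
    truncSemigroup a α S f (k + 1) 0 x = f x := by
  simp only [truncSemigroup, btmProb_succ_zero, ite_mul, one_mul, zero_mul, Finset.sum_ite_eq]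
  split_ifs with h
  · rfl
  · exact (hfS x h).symm

/-- Finite range confines endpoints; reversibility exchanges the roles of start and end, so the
starting points from which `S` is reached are confined as well. -/
lemma truncSemigroup_eq_zero (k : ℕ) {t : ℝ} (ht : 0 ≤ t) {x : Site d}
    (hx : x ∉ fatten^[k] S) : truncSemigroup a α S f k t x = 0 := by
  refine Finset.sum_eq_zero fun y hy => ?_
  have h1 : btmProb a α k t y x = 0 := btmProb_eq_zero k t fun h =>
    hx (fatten_mono.iterate k (Finset.singleton_subset_iff.2 hy) h)
  have h2 := env_mul_btmProb_comm (a := a) (α := α) k x y ht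
  rw [h1, mul_zero, mul_eq_zero] at h2
  rw [h2.resolve_left (env_pos α x).ne', zero_mul]

lemma sum_truncSemigroup_mul_env (Λ : Finset (Site d)) (k : ℕ) {t : ℝ} (ht : 0 ≤ t) :
    ∑ x ∈ Λ, truncSemigroup a α S f k t x * α x
      = ∑ y ∈ S, f y * α y * ∑ x ∈ Λ, btmProb a α k t y x := by
  simp only [truncSemigroup, Finset.sum_mul, Finset.mul_sum]
  rw [Finset.sum_comm]
  refine Finset.sum_congr rfl fun y _ => Finset.sum_congr rfl fun x _ => ?_
  have := env_mul_btmProb_comm (a := a) (α := α) k x y ht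
  linear_combination f y * this

lemma sum_truncSemigroup_mul_env_le (hf : ∀ x, 0 ≤ f x) (Λ : Finset (Site d)) (k : ℕ) {t : ℝ}
    (ht : 0 ≤ t) : ∑ x ∈ Λ, truncSemigroup a α S f k t x * α x ≤ ∑ y ∈ S, f y * α y := by
  rw [sum_truncSemigroup_mul_env Λ k ht]
  exact Finset.sum_le_sum fun y _ => mul_le_of_le_one_right
    (mul_nonneg (hf y) (env_pos α y).le) (sum_btmProb_le_one k y Λ ht)

/-- The `α`-mass lost by the truncated semigroup is controlled by the law of the jump times. -/
lemma sub_sum_truncSemigroup_le (hf : ∀ x, 0 ≤ f x) {Λ : Finset (Site d)} {k : ℕ} {t : ℝ}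
    (ht : 0 ≤ t) (hΛ : fatten^[k] S ⊆ Λ) :
    ∑ y ∈ S, f y * α y - ∑ x ∈ Λ, truncSemigroup a α S f k t x * α x
      ≤ ∑ y ∈ S, f y * α y * (Real.exp t * jumpLaplace a α k y) := by
  rw [sum_truncSemigroup_mul_env Λ k ht, ← Finset.sum_sub_distrib]
  refine Finset.sum_le_sum fun y hy => ?_
  rw [← mul_one_sub]
  refine mul_le_mul_of_nonneg_left (one_sub_sum_btmProb_le k y Λ ?_ ht)
    (mul_nonneg (hf y) (env_pos α y).le)
  exact (fatten_mono.iterate k (Finset.singleton_subset_iff.2 hy)).trans hΛ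

lemma subset_iterate_fatten (k : ℕ) (S : Finset (Site d)) : S ⊆ fatten^[k] S := by
  induction k with
  | zero => exact subset_rfl
  | succ k ih =>
    rw [Function.iterate_succ_apply']
    exact ih.trans (subset_fatten _)

end TruncatedSemigroup

/-! ### Algebra of pairings and linearity of expectations. -/

section Pairing

variable {d : ℕ} {a : ℝ} {α : Env d} {η : Config α}

lemma pairing_of_subset {Λ T : Finset (Site d)} (h : Λ ⊆ T) {g : Site d → ℝ}
    (hg : ∀ x ∉ Λ, g x = 0) (η : Config α) : pairing Λ g η = pairing T g η :=
  Finset.sum_subset h fun x _ hx => by rw [hg x hx, zero_mul]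

lemma pairing_add (Λ : Finset (Site d)) (g h : Site d → ℝ) (η : Config α) :
    pairing Λ g η + pairing Λ h η = pairing Λ (fun x => g x + h x) η := by
  simp only [pairing, add_mul, Finset.sum_add_distrib]

lemma pairing_mul_pairing (Λ : Finset (Site d)) (g h : Site d → ℝ) (η : Config α) :
    pairing Λ g η * pairing Λ h η
      = ∑ p ∈ Λ ×ˢ Λ, (g p.1 * h p.2) * (((η p.1 : ℕ) : ℝ) * ((η p.2 : ℕ) : ℝ)) := by
  rw [pairing, pairing, Finset.sum_mul_sum, Finset.sum_product]
  exact Finset.sum_congr rfl fun x _ => Finset.sum_congr rfl fun y _ => by ring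

variable {Ω : Type*} {mΩ : MeasurableSpace Ω} {P : Measure Ω} {ξ : ℝ≥0 → Ω → Config α}

lemma expect_const_mul (c : ℝ) (φ : Config α → ℝ) (s : ℝ) :
    expect P ξ (fun ζ => c * φ ζ) s = c * expect P ξ φ s :=
  integral_const_mul _ _

variable [IsProbabilityMeasure P]

lemma IsExclusionProcess.expect_mono (h : IsExclusionProcess a α η P ξ) {φ ψ : Config α → ℝ}
    (hφ : IsLocal φ) (hψ : IsLocal ψ) (hle : ∀ ζ, φ ζ ≤ ψ ζ) (s : ℝ) :
    expect P ξ φ s ≤ expect P ξ ψ s :=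
  integral_mono (h.integrable hφ _) (h.integrable hψ _) fun _ => hle _

lemma IsExclusionProcess.expect_add (h : IsExclusionProcess a α η P ξ) {φ ψ : Config α → ℝ}
    (hφ : IsLocal φ) (hψ : IsLocal ψ) (s : ℝ) :
    expect P ξ φ s + expect P ξ ψ s = expect P ξ (fun ζ => φ ζ + ψ ζ) s :=
  (integral_add (h.integrable hφ _) (h.integrable hψ _)).symm

end Pairing

/-! ### Moment bounds along a backward equation with non-negative source. -/

section Supersolution

variable {d : ℕ} {a : ℝ} {α : Env d}

/-- The generator `∑_{z ∼ x} btmRate a α x z (g z - g x)` of `BTM(a)`. -/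
def btmGen (a : ℝ) (α : Env d) (g : Site d → ℝ) (x : Site d) : ℝ :=
  ∑ z ∈ nbrs x, btmRate a α x z * (g z - g x)

/-- `G` is, on the time interval `[0, t]`, a non-negative solution of the time-reversed equation
`∂ₛ G = -A G + D` with source `D ≥ 0`, carried by the finite set `Λ`. -/
structure BackwardSupersolution (a : ℝ) (α : Env d) (Λ : Finset (Site d)) (t : ℝ)
    (G D : ℝ → Site d → ℝ) : Prop where
  cont : ∀ x, Continuous fun s => G s x
  nonneg : ∀ s ∈ Set.Icc 0 t, ∀ x, 0 ≤ G s x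
  support : ∀ s ∈ Set.Icc 0 t, ∀ x ∉ Λ, G s x = 0
  deriv : ∀ s ∈ Set.Ioo 0 t, ∀ x, HasDerivAt (fun s => G s x) (D s x - btmGen a α (G s) x) s
  source_nonneg : ∀ s ∈ Set.Ioo 0 t, ∀ x, 0 ≤ D s x

namespace BackwardSupersolution

variable {Λ : Finset (Site d)} {t : ℝ} {G D : ℝ → Site d → ℝ}

/-- `G` vanishes identically in time off `Λ`. The source itself may be nonzero next to `Λ`, whence
the sums of `D` over `fatten Λ`. -/
lemma deriv_eq_zero (hG : BackwardSupersolution a α Λ t G D) {s : ℝ} (hs : s ∈ Set.Ioo 0 t)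
    {x : Site d} (hx : x ∉ Λ) : D s x - btmGen a α (G s) x = 0 := by
  refine (hG.deriv s hs x).unique ((hasDerivAt_const s (0 : ℝ)).congr_of_eventuallyEq ?_)
  filter_upwards [Ioo_mem_nhds hs.1 hs.2] with u hu
    using hG.support u (Set.Ioo_subset_Icc_self hu) x hx

/-- By detailed balance the generator conserves `α`-mass, so only the source contributes. -/
lemma hasDerivAt_mass (hG : BackwardSupersolution a α Λ t G D) {s : ℝ} (hs : s ∈ Set.Ioo 0 t) :
    HasDerivAt (fun s => ∑ x ∈ Λ, G s x * α x) (∑ x ∈ fatten Λ, D s x * α x) s := by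
  refine (HasDerivAt.fun_sum fun x _ => (hG.deriv s hs x).mul_const (α x : ℝ)).congr_deriv ?_
  rw [Finset.sum_subset (subset_fatten Λ) fun x _ hx => by
    rw [hG.deriv_eq_zero hs hx, zero_mul]]
  have h0 := sum_nbrs_eq_zero_of_antisymm (Λ := Λ)
    (A := fun x z => (α x : ℝ) * btmRate a α x z * (G s z - G s x))
    (fun x z => by
      rw [env_mul_btmRate_comm]
      ring)
    fun x z hx hz => by
      simp [hG.support s (Set.Ioo_subset_Icc_self hs) x hx,
        hG.support s (Set.Ioo_subset_Icc_self hs) z hz]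
  have h1 : ∑ x ∈ fatten Λ, btmGen a α (G s) x * α x = 0 := by
    rw [← h0]
    refine Finset.sum_congr rfl fun x _ => ?_
    rw [btmGen, Finset.sum_mul]
    exact Finset.sum_congr rfl fun z _ => by ring
  simp only [sub_mul, Finset.sum_sub_distrib, h1, sub_zero]

lemma continuous_mass (hG : BackwardSupersolution a α Λ t G D) :
    Continuous fun s => ∑ x ∈ Λ, G s x * α x :=
  continuous_finsetSum _ fun x _ => (hG.cont x).mul continuous_const

lemma pairing_add_exclGen (hG : BackwardSupersolution a α Λ t G D) {s : ℝ}
    (hs : s ∈ Set.Ioo 0 t) (ζ : Config α) :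
    pairing Λ (fun x => D s x - btmGen a α (G s) x) ζ + exclGen a α (pairing Λ (G s)) ζ
      = pairing (fatten Λ) (D s) ζ := by
  rw [pairing_of_subset (subset_fatten Λ) fun x hx => hG.deriv_eq_zero hs hx,
    exclGen_pairing (hG.support s (Set.Ioo_subset_Icc_self hs)), pairing_add]
  congr 1
  funext x
  exact sub_add_cancel _ _

variable {η : Config α} {Ω : Type*} {mΩ : MeasurableSpace Ω} {P : Measure Ω}
  {ξ : ℝ≥0 → Ω → Config α} [IsProbabilityMeasure P]

lemma hasDerivAt_expect (hG : BackwardSupersolution a α Λ t G D)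
    (h : IsExclusionProcess a α η P ξ) {s : ℝ} (hs : s ∈ Set.Ioo 0 t) :
    HasDerivAt (fun s => expect P ξ (pairing Λ (G s)) s)
      (expect P ξ (pairing (fatten Λ) (D s)) s) s := by
  refine (h.hasDerivAt_expect_sum Λ isLocal_coord hs.1 (hG.deriv s hs)).congr_deriv ?_
  refine (h.expect_add (isLocal_pairing Λ _) (isLocal_pairing Λ _).exclGen s).trans ?_
  exact congrArg (expect P ξ · s) (funext fun ζ => hG.pairing_add_exclGen hs ζ)

lemma continuous_expect (hG : BackwardSupersolution a α Λ t G D)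
    (h : IsExclusionProcess a α η P ξ) :
    Continuous fun s => expect P ξ (pairing Λ (G s)) s :=
  h.continuous_expect_sum Λ isLocal_coord hG.cont

/-- Because `η ≤ α`, the mass dominates the source's effect on the process uniformly in the
configuration. -/
lemma expect_source_le (hG : BackwardSupersolution a α Λ t G D)
    (h : IsExclusionProcess a α η P ξ) {s : ℝ} (hs : s ∈ Set.Ioo 0 t) :
    expect P ξ (pairing (fatten Λ) (D s)) s ≤ ∑ x ∈ fatten Λ, D s x * α x := by
  have hint := h.integrable (isLocal_pairing (fatten Λ) (D s)) s.toNNReal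
  refine (integral_mono hint (integrable_const _)
    fun ω => pairing_le (hG.source_nonneg s hs) _).trans ?_
  simp

/-- First moment: the expected pairing grows at most as much as the mass. -/
lemma expect_pairing_le (hG : BackwardSupersolution a α Λ t G D)
    (h : IsExclusionProcess a α η P ξ) (ht : 0 ≤ t) :
    expect P ξ (pairing Λ (G t)) t - ∑ x ∈ Λ, G t x * α x
      ≤ pairing Λ (G 0) η - ∑ x ∈ Λ, G 0 x * α x := by
  have hanti : AntitoneOn (fun s => expect P ξ (pairing Λ (G s)) s - ∑ x ∈ Λ, G s x * α x)
      (Set.Icc 0 t) := by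
    refine antitoneOn_of_hasDerivWithinAt_nonpos (convex_Icc 0 t)
      ((hG.continuous_expect h).sub hG.continuous_mass).continuousOn (f' := fun s =>
        expect P ξ (pairing (fatten Λ) (D s)) s - ∑ x ∈ fatten Λ, D s x * α x) ?_ ?_
    · intro s hs
      rw [interior_Icc] at hs
      exact ((hG.hasDerivAt_expect h hs).sub (hG.hasDerivAt_mass hs)).hasDerivWithinAt
    · intro s hs
      rw [interior_Icc] at hs
      exact sub_nonpos.2 (hG.expect_source_le h hs)
  have := hanti (Set.left_mem_Icc.2 ht) (Set.right_mem_Icc.2 ht) ht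
  simpa only [h.expect_zero] using this

lemma hasDerivAt_expect_sq (hG : BackwardSupersolution a α Λ t G D)
    (h : IsExclusionProcess a α η P ξ) {s : ℝ} (hs : s ∈ Set.Ioo 0 t) :
    HasDerivAt (fun s => expect P ξ (fun ζ => pairing Λ (G s) ζ ^ 2) s)
      (expect P ξ (fun ζ => 2 * pairing Λ (G s) ζ *
        pairing Λ (fun x => D s x - btmGen a α (G s) x) ζ
        + exclGen a α (fun ζ => pairing Λ (G s) ζ ^ 2) ζ) s) s := by
  have h1 := h.hasDerivAt_expect_sum (Λ ×ˢ Λ) (fun p => isLocal_coord_mul p.1 p.2) hs.1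
    (fun p => (hG.deriv s hs p.1).fun_mul (hG.deriv s hs p.2))
  simp only [add_mul, Finset.sum_add_distrib, ← pairing_mul_pairing, ← pow_two] at h1
  refine h1.congr_deriv ?_
  have hl : IsLocal fun ζ : Config α =>
      pairing Λ (fun x => D s x - btmGen a α (G s) x) ζ * pairing Λ (G s) ζ
        + pairing Λ (G s) ζ * pairing Λ (fun x => D s x - btmGen a α (G s) x) ζ :=
    ((isLocal_pairing Λ _).mul (isLocal_pairing Λ _)).add
      ((isLocal_pairing Λ _).mul (isLocal_pairing Λ _))
  refine (congrArg₂ (· + ·) (congrArg (expect P ξ · s) (funext fun ζ => ?_)) rfl).trans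
    ((h.expect_add hl (isLocal_pairing_sq Λ (G s)).exclGen s).trans
      (congrArg (expect P ξ · s) (funext fun ζ => ?_)))
  · rw [pairing_mul_pairing, pairing_mul_pairing]
  · ring

lemma continuous_expect_sq (hG : BackwardSupersolution a α Λ t G D)
    (h : IsExclusionProcess a α η P ξ) :
    Continuous fun s => expect P ξ (fun ζ => pairing Λ (G s) ζ ^ 2) s := by
  simp only [pow_two, pairing_mul_pairing]
  exact h.continuous_expect_sum (Λ ×ˢ Λ) (fun p => isLocal_coord_mul p.1 p.2)
    fun p => (hG.cont p.1).mul (hG.cont p.2)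

lemma hasDerivAt_expect_pairing_sq (hG : BackwardSupersolution a α Λ t G D)
    (h : IsExclusionProcess a α η P ξ) {s : ℝ} (hs : s ∈ Set.Ioo 0 t) :
    HasDerivAt (fun s => expect P ξ (pairing Λ fun x => G s x ^ 2) s)
      (expect P ξ (fun ζ => pairing Λ (fun x => 2 * G s x * (D s x - btmGen a α (G s) x)) ζ
        + exclGen a α (pairing Λ fun x => G s x ^ 2) ζ) s) s := by
  have h1 := h.hasDerivAt_expect_sum Λ isLocal_coord hs.1 fun x => (hG.deriv s hs x).fun_pow 2
  refine h1.congr_deriv ?_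
  refine (h.expect_add (isLocal_pairing Λ _) (isLocal_pairing Λ _).exclGen s).trans ?_
  simp

/-- From `A(G²) = Γ(G) + 2 G A G`, the free carré du champ `Γ(G)` equals `(∂ₛ + A) G² - 2 G D`, and
`G D ≥ 0`. -/
lemma carre_le (hG : BackwardSupersolution a α Λ t G D) {s : ℝ} (hs : s ∈ Set.Ioo 0 t)
    (ζ : Config α) :
    pairing (fatten Λ) (fun x => ∑ z ∈ nbrs x, btmRate a α x z * (G s z - G s x) ^ 2) ζ
      ≤ pairing Λ (fun x => 2 * G s x * (D s x - btmGen a α (G s) x)) ζ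
        + exclGen a α (pairing Λ fun x => G s x ^ 2) ζ := by
  have hsup := hG.support s (Set.Ioo_subset_Icc_self hs)
  rw [pairing_of_subset (subset_fatten Λ) fun x hx => by rw [hsup x hx, mul_zero, zero_mul],
    exclGen_pairing fun x hx => by rw [hsup x hx, zero_pow two_ne_zero], pairing_add]
  refine pairing_mono (fun x _ => ?_) ζ
  have h1 : 0 ≤ 2 * G s x * D s x := mul_nonneg
    (mul_nonneg zero_le_two (hG.nonneg s (Set.Ioo_subset_Icc_self hs) x)) (hG.source_nonneg s hs x)
  have h2 : ∑ z ∈ nbrs x, btmRate a α x z * (G s z ^ 2 - G s x ^ 2)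
      = ∑ z ∈ nbrs x, btmRate a α x z * (G s z - G s x) ^ 2 + 2 * G s x * btmGen a α (G s) x := by
    rw [btmGen, Finset.mul_sum, ← Finset.sum_add_distrib]
    exact Finset.sum_congr rfl fun z _ => by ring
  rw [h2]
  linarith

/-- Second moment: the variance is dominated by that of independent particles, up to the growth of
the mass. -/
lemma expect_sq_le (hG : BackwardSupersolution a α Λ t G D)
    (h : IsExclusionProcess a α η P ξ) (ht : 0 ≤ t) {C : ℝ}
    (hC : ∀ s ∈ Set.Ioo 0 t, ∑ x ∈ Λ, G s x * α x ≤ C) :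
    expect P ξ (fun ζ => pairing Λ (G t) ζ ^ 2) t
        - 2 * pairing Λ (G 0) η * expect P ξ (pairing Λ (G t)) t + pairing Λ (G 0) η ^ 2
      ≤ expect P ξ (pairing Λ fun x => G t x ^ 2) t - pairing Λ (fun x => G 0 x ^ 2) η
        + 2 * C * (∑ x ∈ Λ, G t x * α x - ∑ x ∈ Λ, G 0 x * α x) := by
  set κ := pairing Λ (G 0) η with hκ
  have hκ0 : 0 ≤ κ := pairing_nonneg (hG.nonneg 0 (Set.left_mem_Icc.2 ht)) η
  -- The pairing with `G²` absorbs the carré du champ. The source leaves `2⟨η, G⟩⟨η, D⟩ ≤ 2C⟨η, D⟩`,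
  -- absorbed by the mass term; the source in `-2κ E⟨η, G⟩` has a favourable sign.
  have hanti : AntitoneOn (fun s => expect P ξ (fun ζ => pairing Λ (G s) ζ ^ 2) s
      - 2 * κ * expect P ξ (pairing Λ (G s)) s - expect P ξ (pairing Λ fun x => G s x ^ 2) s
      - 2 * C * ∑ x ∈ Λ, G s x * α x) (Set.Icc 0 t) := by
    refine antitoneOn_of_hasDerivWithinAt_nonpos (convex_Icc 0 t) (f' := fun s =>
      expect P ξ (fun ζ => 2 * pairing Λ (G s) ζ *
        pairing Λ (fun x => D s x - btmGen a α (G s) x) ζ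
        + exclGen a α (fun ζ => pairing Λ (G s) ζ ^ 2) ζ) s
      - 2 * κ * expect P ξ (pairing (fatten Λ) (D s)) s
      - expect P ξ (fun ζ => pairing Λ (fun x => 2 * G s x * (D s x - btmGen a α (G s) x)) ζ
        + exclGen a α (pairing Λ fun x => G s x ^ 2) ζ) s
      - 2 * C * ∑ x ∈ fatten Λ, D s x * α x) ?_ ?_ ?_
    · have hsq : Continuous fun s => expect P ξ (pairing Λ fun x => G s x ^ 2) s :=
        h.continuous_expect_sum Λ isLocal_coord fun x => (hG.cont x).pow 2
      exact ((((hG.continuous_expect_sq h).sub (continuous_const.mul (hG.continuous_expect h))).sub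
        hsq).sub (continuous_const.mul hG.continuous_mass)).continuousOn
    · intro s hs
      rw [interior_Icc] at hs
      exact ((((hG.hasDerivAt_expect_sq h hs).sub ((hG.hasDerivAt_expect h hs).const_mul _)).sub
        (hG.hasDerivAt_expect_pairing_sq h hs)).sub
        ((hG.hasDerivAt_mass hs).const_mul _)).hasDerivWithinAt
    · intro s hs
      rw [interior_Icc] at hs
      have hs' := Set.Ioo_subset_Icc_self hs
      have hC0 : 0 ≤ C := (Finset.sum_nonneg fun x _ =>
        mul_nonneg (hG.nonneg s hs' x) (env_pos α x).le).trans (hC s hs)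
      have hpoint : ∀ ζ : Config α, (2 * pairing Λ (G s) ζ *
            pairing Λ (fun x => D s x - btmGen a α (G s) x) ζ
            + exclGen a α (fun ζ => pairing Λ (G s) ζ ^ 2) ζ)
          ≤ (pairing Λ (fun x => 2 * G s x * (D s x - btmGen a α (G s) x)) ζ
            + exclGen a α (pairing Λ fun x => G s x ^ 2) ζ)
          + 2 * C * pairing (fatten Λ) (D s) ζ := by
        intro ζ
        have e1 := exclGen_pairing_sq_le (a := a) (hG.support s hs') ζ
        have e2 := hG.pairing_add_exclGen hs ζ
        have e3 := hG.carre_le hs ζ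
        have e4 : pairing Λ (G s) ζ * pairing (fatten Λ) (D s) ζ
            ≤ C * pairing (fatten Λ) (D s) ζ :=
          mul_le_mul_of_nonneg_right ((pairing_le (hG.nonneg s hs') ζ).trans (hC s hs))
            (pairing_nonneg (hG.source_nonneg s hs) ζ)
        rw [← e2] at e4 ⊢
        linarith
      have hl1 := ((isLocal_const (α := α) 2).mul (isLocal_pairing Λ (G s))).mul
        (isLocal_pairing Λ fun x => D s x - btmGen a α (G s) x)
      have hl2 := (isLocal_pairing (α := α) Λ
        fun x => 2 * G s x * (D s x - btmGen a α (G s) x)).add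
        ((isLocal_pairing Λ fun x => G s x ^ 2).exclGen (a := a))
      have hl3 := (isLocal_const (α := α) (2 * C)).mul (isLocal_pairing (fatten Λ) (D s))
      have hmono := h.expect_mono (hl1.add (isLocal_pairing_sq Λ (G s)).exclGen) (hl2.add hl3)
        hpoint s
      rw [← h.expect_add hl2 hl3, expect_const_mul] at hmono
      have hD0 : 0 ≤ expect P ξ (pairing (fatten Λ) (D s)) s :=
        integral_nonneg fun ω => pairing_nonneg (hG.source_nonneg s hs) _
      have h1 := mul_le_mul_of_nonneg_left (hG.expect_source_le h hs) (mul_nonneg zero_le_two hC0)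
      have h2 := mul_nonneg (mul_nonneg zero_le_two hκ0) hD0
      linarith
  have := hanti (Set.left_mem_Icc.2 ht) (Set.right_mem_Icc.2 ht) ht
  simp only [h.expect_zero] at this
  linarith

end BackwardSupersolution

end Supersolution

/-! ### Removing the truncation. -/

section Limit

variable {d : ℕ} {a : ℝ} {α : Env d} {S : Finset (Site d)} {f : Site d → ℝ}

/-- The first jump lowers the level from `k + 1` to `k`, so the source is the gap between the two
levels seen through one jump; it is non-negative by monotonicity in `k`. -/
lemma backwardSupersolution_truncSemigroup (S : Finset (Site d)) (hf : ∀ x, 0 ≤ f x) (k : ℕ)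
    (t : ℝ) :
    BackwardSupersolution a α (fatten^[k + 1] S) t
      (fun s => truncSemigroup a α S f (k + 1) (t - s))
      (fun s x => ∑ z ∈ nbrs x, btmRate a α x z *
        (truncSemigroup a α S f (k + 1) (t - s) z - truncSemigroup a α S f k (t - s) z)) where
  cont x := (continuous_truncSemigroup (k + 1) x).comp (continuous_const.sub continuous_id)
  nonneg s hs x := truncSemigroup_nonneg hf _ (sub_nonneg.2 hs.2) x
  support s hs x hx := truncSemigroup_eq_zero _ (sub_nonneg.2 hs.2) hx
  deriv s hs x := by
    refine ((hasDerivAt_truncSemigroup k x (t - s)).scomp s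
      ((hasDerivAt_id s).const_sub t)).congr_deriv ?_
    simp only [btmGen, ← Finset.sum_sub_distrib, smul_eq_mul, Finset.mul_sum]
    exact Finset.sum_congr rfl fun z _ => by ring
  source_nonneg s hs x := Finset.sum_nonneg fun z _ => mul_nonneg (btmRate_nonneg _ _)
    (sub_nonneg.2 (truncSemigroup_le_succ hf k (sub_nonneg.2 hs.2.le) z))

lemma sum_iterate_fatten_eq (hfS : ∀ x ∉ S, f x = 0) (k : ℕ) (w : Site d → ℝ) :
    ∑ x ∈ fatten^[k] S, f x * w x = ∑ x ∈ S, f x * w x :=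
  (Finset.sum_subset (subset_iterate_fatten k S) fun x _ hx => by rw [hfS x hx, zero_mul]).symm

variable {η : Config α} {Ω : Type*} {mΩ : MeasurableSpace Ω} {P : Measure Ω}
  {ξ : ℝ≥0 → Ω → Config α} [IsProbabilityMeasure P]

lemma expect_pairing_le_trunc (h : IsExclusionProcess a α η P ξ) (hf : ∀ x, 0 ≤ f x)
    (hfS : ∀ x ∉ S, f x = 0) (k : ℕ) {t : ℝ} (ht : 0 ≤ t) :
    expect P ξ (pairing S f) t
      ≤ pairing (fatten^[k + 1] S) (truncSemigroup a α S f (k + 1) t) η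
        + ∑ y ∈ S, f y * α y * (Real.exp t * jumpLaplace a α (k + 1) y) := by
  have h1 := (backwardSupersolution_truncSemigroup S hf k t).expect_pairing_le h ht
  have h2 := sub_sum_truncSemigroup_le (a := a) (α := α) hf (S := S) (k := k + 1) ht subset_rfl
  have h3 : truncSemigroup a α S f (k + 1) 0 = f := funext fun x => truncSemigroup_zero hfS k x
  have h4 : pairing (α := α) (fatten^[k + 1] S) f = pairing S f :=
    funext fun ζ => (pairing_of_subset (subset_iterate_fatten (k + 1) S) hfS ζ).symm
  simp only [sub_self, sub_zero, h3, h4] at h1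
  rw [sum_iterate_fatten_eq hfS] at h1
  linarith

lemma expect_sq_le_trunc (h : IsExclusionProcess a α η P ξ) (hf : ∀ x, 0 ≤ f x)
    (hfS : ∀ x ∉ S, f x = 0) (k : ℕ) {t : ℝ} (ht : 0 ≤ t) :
    expect P ξ (fun ζ => pairing S f ζ ^ 2) t
      - 2 * pairing (fatten^[k + 1] S) (truncSemigroup a α S f (k + 1) t) η
        * expect P ξ (pairing S f) t
      + pairing (fatten^[k + 1] S) (truncSemigroup a α S f (k + 1) t) η ^ 2
    ≤ pairing (fatten^[k + 1] S) (truncSemigroup a α S (fun x => f x ^ 2) (k + 1) t) η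
      - pairing (fatten^[k + 1] S) (fun x => truncSemigroup a α S f (k + 1) t x ^ 2) η
      + ∑ y ∈ S, f y ^ 2 * α y * (Real.exp t * jumpLaplace a α (k + 1) y)
      + 2 * (∑ y ∈ S, f y * α y)
        * ∑ y ∈ S, f y * α y * (Real.exp t * jumpLaplace a α (k + 1) y) := by
  have hf2S : ∀ x ∉ S, f x ^ 2 = 0 := fun x hx => by rw [hfS x hx, zero_pow two_ne_zero]
  -- The second-moment bound leaves `E⟨η_t, f²⟩`, which the first-moment bound for `f²` controls.
  have h0 := expect_pairing_le_trunc h (fun x => sq_nonneg (f x)) hf2S k ht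
  have h1 := (backwardSupersolution_truncSemigroup S hf k t).expect_sq_le h ht
    (C := ∑ y ∈ S, f y * α y)
    fun s hs => sum_truncSemigroup_mul_env_le hf _ _ (sub_nonneg.2 hs.2.le)
  have h2 := sub_sum_truncSemigroup_le (a := a) (α := α) hf (S := S) (k := k + 1) ht subset_rfl
  have h3 : truncSemigroup a α S f (k + 1) 0 = f := funext fun x => truncSemigroup_zero hfS k x
  have hsub := subset_iterate_fatten (k + 1) S
  have h4 : pairing (α := α) (fatten^[k + 1] S) f = pairing S f :=
    funext fun ζ => (pairing_of_subset hsub hfS ζ).symm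
  have h5 : pairing (α := α) (fatten^[k + 1] S) (fun x => f x ^ 2) = pairing S fun x => f x ^ 2 :=
    funext fun ζ => (pairing_of_subset hsub hf2S ζ).symm
  simp only [sub_self, sub_zero, h3, h4, h5] at h1
  rw [sum_iterate_fatten_eq hfS] at h1
  have hC : 0 ≤ ∑ y ∈ S, f y * α y :=
    Finset.sum_nonneg fun y _ => mul_nonneg (hf y) (env_pos α y).le
  have h6 := mul_le_mul_of_nonneg_left h2 (mul_nonneg zero_le_two hC)
  linarith

lemma btmProb_le_one (k : ℕ) (x y : Site d) {t : ℝ} (ht : 0 ≤ t) : btmProb a α k t x y ≤ 1 := by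
  simpa using sum_btmProb_le_one (a := a) (α := α) k x {y} ht

lemma tendsto_btmProb (x y : Site d) {t : ℝ} (ht : 0 ≤ t) :
    Tendsto (fun k => btmProb a α k t x y) atTop (𝓝 (btmTransition a α t x y).toReal) := by
  have h1 : btmTransition a α t x y = ⨆ k, ENNReal.ofReal (btmProb a α k t x y) := by
    simp only [btmTransition, btmIter_eq_ofReal _ x y ht]
  have h2 : Monotone fun k => ENNReal.ofReal (btmProb a α k t x y) :=
    ENNReal.ofReal_mono.comp (btmProb_monotone x y ht)
  have h3 : btmTransition a α t x y ≠ ∞ := by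
    refine ne_top_of_le_ne_top ENNReal.one_ne_top ?_
    rw [h1]
    exact iSup_le fun k => ENNReal.ofReal_le_one.2 (btmProb_le_one k x y ht)
  have h4 := tendsto_atTop_iSup h2
  rw [← h1] at h4
  refine ((ENNReal.tendsto_toReal h3).comp h4).congr fun k => ?_
  exact ENNReal.toReal_ofReal (btmProb_nonneg k x y ht)

/-- The semigroup of `BTM(a)` acting on functions carried by a finite set `S`. -/
def btmSemigroup (a : ℝ) (α : Env d) (S : Finset (Site d)) (f : Site d → ℝ) (t : ℝ) (x : Site d) :
    ℝ :=
  ∑ y ∈ S, (btmTransition a α t x y).toReal * f y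

lemma tendsto_truncSemigroup (x : Site d) {t : ℝ} (ht : 0 ≤ t) :
    Tendsto (fun k => truncSemigroup a α S f k t x) atTop (𝓝 (btmSemigroup a α S f t x)) :=
  tendsto_finsetSum _ fun y _ => (tendsto_btmProb x y ht).mul_const _

lemma truncSemigroup_le (hf : ∀ x, 0 ≤ f x) (k : ℕ) {t : ℝ} (ht : 0 ≤ t) (x : Site d) :
    truncSemigroup a α S f k t x ≤ btmSemigroup a α S f t x :=
  (monotone_nat_of_le_succ fun k => truncSemigroup_le_succ hf k ht x).ge_of_tendsto
    (tendsto_truncSemigroup x ht) k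

lemma btmSemigroup_nonneg (hf : ∀ x, 0 ≤ f x) (t : ℝ) (x : Site d) :
    0 ≤ btmSemigroup a α S f t x :=
  Finset.sum_nonneg fun y _ => mul_nonneg ENNReal.toReal_nonneg (hf y)

lemma btmSemigroup_le_sum (hf : ∀ x, 0 ≤ f x) {t : ℝ} (ht : 0 ≤ t) (x : Site d) :
    btmSemigroup a α S f t x ≤ ∑ y ∈ S, f y :=
  Finset.sum_le_sum fun y _ => mul_le_of_le_one_left (hf y)
    (le_of_tendsto' (tendsto_btmProb x y ht) fun k => btmProb_le_one k x y ht)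

/-- Reversibility turns the sum over starting points into a sum over endpoints of a sub-probability.
This provides the dominating function for the limit `k → ∞`. -/
lemma summable_btmSemigroup_mul_env {t : ℝ} (ht : 0 ≤ t) :
    Summable fun x => btmSemigroup a α S f t x * α x := by
  have h1 : ∀ x y, (α x : ℝ) * (btmTransition a α t x y).toReal
      = α y * (btmTransition a α t y x).toReal := fun x y =>
    tendsto_nhds_unique ((tendsto_btmProb x y ht).const_mul _)
      (((tendsto_btmProb y x ht).const_mul _).congr fun k => (env_mul_btmProb_comm k x y ht).symm)
  have h2 : ∀ y, Summable fun x => (btmTransition a α t y x).toReal := fun y =>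
    summable_of_sum_le (fun _ => ENNReal.toReal_nonneg) fun Λ =>
      le_of_tendsto' (tendsto_finsetSum Λ fun x _ => tendsto_btmProb y x ht)
        fun k => sum_btmProb_le_one k y Λ ht
  simp only [btmSemigroup, Finset.sum_mul]
  refine summable_sum fun y _ => ((h2 y).mul_left (α y * f y)).congr fun x => ?_
  linear_combination -f y * h1 x y

lemma summable_btmSemigroup_mul (η : Config α) (hf : ∀ x, 0 ≤ f x) {t : ℝ} (ht : 0 ≤ t) :
    Summable fun x => btmSemigroup a α S f t x * ((η x : ℕ) : ℝ) :=
  (summable_btmSemigroup_mul_env ht).of_nonneg_of_le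
    (fun x => mul_nonneg (btmSemigroup_nonneg hf t x) (Nat.cast_nonneg _))
    fun x => mul_le_mul_of_nonneg_left (config_le η x) (btmSemigroup_nonneg hf t x)

lemma summable_btmSemigroup_sq_mul (η : Config α) (hf : ∀ x, 0 ≤ f x) {t : ℝ} (ht : 0 ≤ t) :
    Summable fun x => btmSemigroup a α S f t x ^ 2 * ((η x : ℕ) : ℝ) := by
  refine ((summable_btmSemigroup_mul (a := a) (S := S) η hf ht).mul_left (∑ y ∈ S, f y)).of_nonneg_of_le
    (fun x => mul_nonneg (sq_nonneg _) (Nat.cast_nonneg _)) fun x => ?_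
  rw [pow_two, mul_assoc]
  exact mul_le_mul_of_nonneg_right (btmSemigroup_le_sum hf ht x)
    (mul_nonneg (btmSemigroup_nonneg hf t x) (Nat.cast_nonneg _))

/-- Pairings with functions on growing finite sets converge under domination. -/
lemma tendsto_pairing {Λ : ℕ → Finset (Site d)} {g : ℕ → Site d → ℝ} {g' b : Site d → ℝ}
    (hg : ∀ k, ∀ x ∉ Λ k, g k x = 0) (hlim : ∀ x, Tendsto (fun k => g k x) atTop (𝓝 (g' x)))
    (hb : ∀ k x, |g k x| ≤ b x) (hsum : Summable fun x => b x * ((η x : ℕ) : ℝ)) :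
    Tendsto (fun k => pairing (Λ k) (g k) η) atTop (𝓝 (∑' x, g' x * ((η x : ℕ) : ℝ))) := by
  have h1 : ∀ k, pairing (Λ k) (g k) η = ∑' x, g k x * ((η x : ℕ) : ℝ) := fun k =>
    (tsum_eq_sum fun x hx => by rw [hg k x hx, zero_mul]).symm
  simp only [h1]
  refine tendsto_tsum_of_dominated_convergence hsum (fun x => (hlim x).mul_const _)
    (Eventually.of_forall fun k x => ?_)
  rw [norm_mul, Real.norm_natCast]
  exact mul_le_mul_of_nonneg_right (hb k x) (Nat.cast_nonneg _)

lemma tendsto_pairing_truncSemigroup (η : Config α) (hf : ∀ x, 0 ≤ f x) {t : ℝ} (ht : 0 ≤ t) :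
    Tendsto (fun k => pairing (fatten^[k + 1] S) (truncSemigroup a α S f (k + 1) t) η) atTop
      (𝓝 (∑' x, btmSemigroup a α S f t x * ((η x : ℕ) : ℝ))) :=
  tendsto_pairing (fun k _ hx => truncSemigroup_eq_zero _ ht hx)
    (fun x => (tendsto_truncSemigroup x ht).comp (tendsto_add_atTop_nat 1))
    (fun k x => by
      rw [abs_of_nonneg (truncSemigroup_nonneg hf _ ht x)]
      exact truncSemigroup_le hf _ ht x) (summable_btmSemigroup_mul η hf ht)

lemma tendsto_pairing_truncSemigroup_sq (η : Config α) (hf : ∀ x, 0 ≤ f x) {t : ℝ} (ht : 0 ≤ t) :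
    Tendsto (fun k => pairing (fatten^[k + 1] S)
        (fun x => truncSemigroup a α S f (k + 1) t x ^ 2) η) atTop
      (𝓝 (∑' x, btmSemigroup a α S f t x ^ 2 * ((η x : ℕ) : ℝ))) :=
  tendsto_pairing (fun k _ hx => by rw [truncSemigroup_eq_zero _ ht hx, zero_pow two_ne_zero])
    (fun x => ((tendsto_truncSemigroup x ht).comp (tendsto_add_atTop_nat 1)).pow 2)
    (fun k x => by
      rw [abs_of_nonneg (sq_nonneg _)]
      exact pow_le_pow_left₀ (truncSemigroup_nonneg hf _ ht x) (truncSemigroup_le hf _ ht x) 2)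
    (summable_btmSemigroup_sq_mul η hf ht)

/-- The variance of a linear functional of the exclusion process started from a deterministic
configuration is at most that of independent `BTM(a)` particles. -/
theorem IsExclusionProcess.variance_le (h : IsExclusionProcess a α η P ξ) {K : ℝ}
    (hK : NoFastPath a α K) (hf : ∀ x, 0 ≤ f x) (hfS : ∀ x ∉ S, f x = 0) (t : ℝ≥0) :
    ∫ ω, (pairing S f (ξ t ω) - ∑' x, btmSemigroup a α S f t x * ((η x : ℕ) : ℝ)) ^ 2 ∂P
      ≤ ∑' x, (btmSemigroup a α S (fun x => f x ^ 2) t x - btmSemigroup a α S f t x ^ 2)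
        * ((η x : ℕ) : ℝ) := by
  have ht : 0 ≤ (t : ℝ) := t.coe_nonneg
  have hf2 : ∀ x, 0 ≤ f x ^ 2 := fun x => sq_nonneg _
  have herr : ∀ w : Site d → ℝ, Tendsto (fun k => ∑ y ∈ S, w y * α y *
      (Real.exp t * jumpLaplace a α (k + 1) y)) atTop (𝓝 0) := fun w => by
    have := tendsto_finsetSum S fun y _ => (((tendsto_jumpLaplace hK y).comp
      (tendsto_add_atTop_nat 1)).const_mul (Real.exp t)).const_mul (w y * (α y : ℝ))
    simpa using this
  have hκ := tendsto_pairing_truncSemigroup (a := a) (S := S) η hf ht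
  have hlim := le_of_tendsto_of_tendsto'
    ((tendsto_const_nhds.sub ((hκ.const_mul 2).mul_const _)).add (hκ.pow 2))
    ((((tendsto_pairing_truncSemigroup η hf2 ht).sub
      (tendsto_pairing_truncSemigroup_sq η hf ht)).add (herr fun y => f y ^ 2)).add
      ((herr f).const_mul (2 * ∑ y ∈ S, f y * α y)))
    fun k => expect_sq_le_trunc h hf hfS k ht
  rw [mul_zero, add_zero, add_zero, ← (summable_btmSemigroup_mul η hf2 ht).tsum_sub
    (summable_btmSemigroup_sq_mul η hf ht)] at hlim
  simp only [← sub_mul] at hlim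
  refine le_of_eq_of_le ?_ hlim
  have h1 := h.integrable (isLocal_pairing S f) t
  have h2 := h.integrable (isLocal_pairing_sq S f) t
  simp only [sub_sq, expect, Real.toNNReal_coe]
  have h3 : Integrable (fun ω => 2 * pairing S f (ξ t ω)
      * ∑' x, btmSemigroup a α S f t x * ((η x : ℕ) : ℝ)) P := (h1.const_mul 2).mul_const _
  have h4 : Integrable (fun ω => pairing S f (ξ t ω) ^ 2 - 2 * pairing S f (ξ t ω)
      * ∑' x, btmSemigroup a α S f t x * ((η x : ℕ) : ℝ)) P := h2.sub h3
  rw [integral_add h4 (integrable_const _), integral_sub h2 h3, integral_mul_const,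
    integral_const_mul]
  simp
  ring

end Limit

/-! ### Integrals against the density field as lattice sums. -/

section DensityField

variable {d : ℕ} {a β : ℝ} {α : Env d} {n : ℕ}

lemma scaledSite_injective (hn : 1 ≤ n) : Function.Injective (scaledSite (d := d) n) := by
  intro x y h
  have hn' : (n : ℝ) ≠ 0 := by positivity
  funext i
  have := congrArg (fun z : EuclideanSpace ℝ (Fin d) => z i) h
  simp only [scaledSite] at this
  exact_mod_cast (div_left_inj' hn').1 this

lemma measurableEmbedding_scaledSite (hn : 1 ≤ n) :
    MeasurableEmbedding (scaledSite (d := d) n) :=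
  ⟨scaledSite_injective hn, measurable_of_countable _,
    fun {_} _ => (Set.countable_range _).mono (Set.image_subset_range _ _) |>.measurableSet⟩

lemma finite_scaledSite_mem (hn : 1 ≤ n) {f : EuclideanSpace ℝ (Fin d) → ℝ}
    (hf : HasCompactSupport f) : {x : Site d | f (scaledSite n x) ≠ 0}.Finite := by
  obtain ⟨R, hR⟩ := hf.isBounded.exists_norm_le
  have hn' : (0 : ℝ) < n := by positivity
  refine (Set.finite_Icc (fun _ : Fin d => -⌈R * n⌉) (fun _ => ⌈R * n⌉)).subset fun x hx => ?_
  have h1 : ‖scaledSite n x‖ ≤ R := hR _ (subset_tsupport f hx)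
  have h2 : ∀ i, |(x i : ℝ)| ≤ R * n := fun i => by
    have := (PiLp.norm_apply_le (scaledSite n x) i).trans h1
    rw [scaledSite, Real.norm_eq_abs, abs_div, Nat.abs_cast, div_le_iff₀ hn'] at this
    exact this
  have h3 : ∀ i, |x i| ≤ ⌈R * n⌉ := fun i => by
    have := (h2 i).trans (Int.le_ceil _)
    exact_mod_cast this
  exact ⟨fun i => (abs_le.1 (h3 i)).1, fun i => (abs_le.1 (h3 i)).2⟩

lemma semigroup_scaledSite (hn : 1 ≤ n) (t : ℝ≥0) {f : EuclideanSpace ℝ (Fin d) → ℝ}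
    {S : Finset (Site d)} (hfS : ∀ x ∉ S, f (scaledSite n x) = 0) (x : Site d) :
    semigroup a β α n t f (scaledSite n x)
      = btmSemigroup a α S (fun y => f (scaledSite n y)) ((t * timeScale d β n : ℝ≥0) : ℝ) x := by
  rw [semigroup, (scaledSite_injective hn).extend_apply]
  exact tsum_eq_sum fun y hy => by rw [hfS y hy, mul_zero]

lemma measurable_semigroup (hn : 1 ≤ n) (t : ℝ≥0) (f : EuclideanSpace ℝ (Fin d) → ℝ) :
    Measurable (semigroup a β α n t f) :=
  (measurableEmbedding_scaledSite hn).measurable_extend (measurable_of_countable _)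
    measurable_zero

lemma integrable_sum_dirac {g : EuclideanSpace ℝ (Fin d) → ℝ} (hg : Measurable g)
    {η : Config α} (hs : Summable fun x => |g (scaledSite n x)| * ((η x : ℕ) : ℝ)) :
    Integrable g
      (Measure.sum fun x : Site d => ((η x : ℕ) : ℝ≥0∞) • Measure.dirac (scaledSite n x)) := by
  refine ⟨hg.aestronglyMeasurable, ?_⟩
  rw [HasFiniteIntegral, lintegral_sum_measure]
  simp only [lintegral_smul_measure, lintegral_dirac, smul_eq_mul]
  refine lt_of_le_of_lt (le_of_eq (tsum_congr fun x => ?_)) hs.tsum_ofReal_lt_top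
  rw [mul_comm, ENNReal.ofReal_mul (abs_nonneg _), ENNReal.ofReal_natCast, Real.enorm_eq_ofReal_abs]

lemma integrable_densityField {g : EuclideanSpace ℝ (Fin d) → ℝ} (hg : Measurable g)
    {η : Config α} (hs : Summable fun x => |g (scaledSite n x)| * ((η x : ℕ) : ℝ)) :
    Integrable g (densityField β n η) :=
  (integrable_sum_dirac hg hs).smul_measure ENNReal.ofReal_ne_top

lemma integral_densityField {g : EuclideanSpace ℝ (Fin d) → ℝ} (hg : Measurable g)
    {η : Config α} (hs : Summable fun x => |g (scaledSite n x)| * ((η x : ℕ) : ℝ)) :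
    ∫ z, g z ∂(densityField β n η)
      = 1 / (n : ℝ) ^ ((d : ℝ) / β) * ∑' x, g (scaledSite n x) * ((η x : ℕ) : ℝ) := by
  have h0 : (0 : ℝ) ≤ 1 / (n : ℝ) ^ ((d : ℝ) / β) := by positivity
  rw [densityField, integral_smul_measure, ENNReal.toReal_ofReal h0, smul_eq_mul,
    ← (hasSum_integral_measure (integrable_sum_dirac hg hs)).tsum_eq]
  congr 1
  refine tsum_congr fun x => ?_
  rw [integral_smul_measure, integral_dirac, ENNReal.toReal_natCast, smul_eq_mul, mul_comm]

end DensityField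

end BouchaudExclusion

end

/-! ### The variance estimate in rescaled form. -/

open BouchaudExclusion in
theorem proposition3p1 (d : ℕ) (hd : 1 ≤ d) (β : ℝ) (hβ : β ∈ Set.Ioo (0 : ℝ) 1)
    (a : ℝ) (ha : a ∈ Set.Icc (0 : ℝ) 1)
    (ν : Measure ℕ+) [IsProbabilityMeasure ν] (hν : HeavyTailed ν β) :
    ∀ᵐ α ∂(envLaw d ν),
      ∀ (η : Config α) (Ω : Type*) (mΩ : MeasurableSpace Ω) (P : Measure Ω)
        (_ : IsProbabilityMeasure P) (ξ : ℝ≥0 → Ω → Config α),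
        IsExclusionProcess a α η P ξ →
      ∀ (t : ℝ≥0) (n : ℕ), 1 ≤ n →
      ∀ f : EuclideanSpace ℝ (Fin d) → ℝ, Continuous f → HasCompactSupport f → (∀ z, 0 ≤ f z) →
        -- all the pairings and the expectation are finite
        (∀ ω, Integrable f (densityField β n (ξ (t * timeScale d β n) ω))) ∧
        Integrable (semigroup a β α n t f) (densityField β n η) ∧
        Integrable (fun z => semigroup a β α n t (fun w => f w ^ 2) z
          - (semigroup a β α n t f z) ^ 2) (densityField β n η) ∧
        Integrable (fun ω => (∫ z, f z ∂(densityField β n (ξ (t * timeScale d β n) ω))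
          - ∫ z, semigroup a β α n t f z ∂(densityField β n η)) ^ 2) P ∧
        -- the variance estimate
        ∫ ω, (∫ z, f z ∂(densityField β n (ξ (t * timeScale d β n) ω))
          - ∫ z, semigroup a β α n t f z ∂(densityField β n η)) ^ 2 ∂P
        ≤ 1 / (n : ℝ) ^ ((d : ℝ) / β) *
          ∫ z, (semigroup a β α n t (fun w => f w ^ 2) z
            - (semigroup a β α n t f z) ^ 2) ∂(densityField β n η) := by
  filter_upwards [ae_exists_noFastPath hd ha ν] with α hα
  obtain ⟨K, hK⟩ := hα
  intro η Ω mΩ P _ ξ h t n hn f hfc hfs hf0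
  set s : ℝ≥0 := t * timeScale d β n with hs
  set c : ℝ := 1 / (n : ℝ) ^ ((d : ℝ) / β) with hc
  set S : Finset (Site d) := (finite_scaledSite_mem hn hfs).toFinset with hS
  set F : Site d → ℝ := fun x => f (scaledSite n x) with hF
  have hF0 : ∀ x, 0 ≤ F x := fun x => hf0 _
  have hFS : ∀ x ∉ S, F x = 0 := fun x hx => by
    by_contra hne
    exact hx ((Set.Finite.mem_toFinset _).2 hne)
  have hF2S : ∀ x ∉ S, f (scaledSite n x) ^ 2 = 0 := fun x hx => by
    rw [show f (scaledSite n x) = 0 from hFS x hx, zero_pow two_ne_zero]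
  have hs0 : 0 ≤ (s : ℝ) := s.coe_nonneg
  have hP : ∀ x, semigroup a β α n t f (scaledSite n x) = btmSemigroup a α S F s x :=
    semigroup_scaledSite hn t hFS
  have hP2 : ∀ x, semigroup a β α n t (fun w => f w ^ 2) (scaledSite n x)
      = btmSemigroup a α S (fun y => F y ^ 2) s x := semigroup_scaledSite hn t hF2S
  have hsumf : ∀ ζ : Config α, Summable fun x => |f (scaledSite n x)| * ((ζ x : ℕ) : ℝ) :=
    fun ζ => summable_of_ne_finset_zero (s := S) fun x hx => by
      rw [show f (scaledSite n x) = 0 from hFS x hx, abs_zero, zero_mul]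
  have hsumP : Summable fun x =>
      |semigroup a β α n t f (scaledSite n x)| * ((η x : ℕ) : ℝ) := by
    simp only [hP, abs_of_nonneg (btmSemigroup_nonneg hF0 _ _)]
    exact summable_btmSemigroup_mul η hF0 hs0
  have hsumV : Summable fun x => |semigroup a β α n t (fun w => f w ^ 2) (scaledSite n x)
      - semigroup a β α n t f (scaledSite n x) ^ 2| * ((η x : ℕ) : ℝ) := by
    simp only [hP, hP2]
    have := ((summable_btmSemigroup_mul (a := a) (S := S) η (fun x => sq_nonneg (F x)) hs0).sub
      (summable_btmSemigroup_sq_mul (a := a) (S := S) η hF0 hs0)).abs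
    refine this.congr fun x => ?_
    rw [← sub_mul, abs_mul, Nat.abs_cast]
  have hmV : Measurable fun z => semigroup a β α n t (fun w => f w ^ 2) z
      - semigroup a β α n t f z ^ 2 :=
    (measurable_semigroup hn t _).sub ((measurable_semigroup hn t f).pow_const 2)
  have hX : ∀ ω, ∫ z, f z ∂(densityField β n (ξ s ω)) = c * pairing S F (ξ s ω) := fun ω => by
    rw [integral_densityField hfc.measurable (hsumf _)]
    congr 1
    exact tsum_eq_sum fun x hx => by
      rw [show f (scaledSite n x) = 0 from hFS x hx, zero_mul]
  have hκ : ∫ z, semigroup a β α n t f z ∂(densityField β n η)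
      = c * ∑' x, btmSemigroup a α S F s x * ((η x : ℕ) : ℝ) := by
    rw [integral_densityField (measurable_semigroup hn t f) hsumP]
    simp only [hP, hc]
  refine ⟨fun ω => integrable_densityField hfc.measurable (hsumf _),
    integrable_densityField (measurable_semigroup hn t f) hsumP,
    integrable_densityField hmV hsumV, ?_, ?_⟩
  · simp only [hX, hκ, ← mul_sub, mul_pow]
    refine Integrable.const_mul ?_ _
    have h1 := h.integrable (isLocal_pairing S F) s
    have h2 := h.integrable (isLocal_pairing_sq S F) s
    simp only [sub_sq]
    exact (h2.sub ((h1.const_mul 2).mul_const _)).add (integrable_const _)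
  · rw [integral_densityField hmV hsumV]
    simp only [hX, hκ, ← mul_sub, mul_pow, hP, hP2]
    -- The square produces `c²`; one factor is the prefactor on the right, the other the
    -- normalisation inside the density field.
    rw [integral_const_mul, pow_two, mul_assoc]
    have hc0 : 0 ≤ c := by positivity
    exact mul_le_mul_of_nonneg_left (mul_le_mul_of_nonneg_left (h.variance_le hK hF0 hFS s) hc0) hc0
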